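/- Let $\mathbb T\subset\mathbb R$ be a time scale, i.e. a closed set, unbounded above, with $0\in\mathbb T$; its gaps may be arbitrarily large. Put $\sigma(t)=\inf\{s\in\mathbb T: s>t\}$, $\mu(t)=\sigma(t)-t$ and $\mathbb T_a^+=\mathbb T\cap[a,\infty)$. A function on $\mathbb T$ is rd-continuous if it is continuous at every $t$ with $\sigma(t)=t$ and has finite left limits at the points that are limits of points of $\mathbb T$ from the left; $f^\Delta(t)=\gamma$ means that for every $\varepsilon>0$ one has $|f(\sigma(t))-f(s)-\gamma(\sigma(t)-s)|\le\varepsilon|\sigma(t)-s|$ for all $s\in\mathbb T$ near $t$; and $\int_a^b f\,\Delta\tau=F(b)-F(a)$ whenever $F^\Delta=f$. Let $|\cdot|$ be the Euclidean norm on $\mathbb K^n$ ($\mathbb K=\mathbb R$ or $\mathbb C$) and the corresponding operator norm. Let $\mathcal A:\mathbb T\to M_n(\mathbb K)$ be rd-continuous, bounded and uniformly regressive, i.e. $E_n+\mu(t)\mathcal A(t)$ is invertible for all $t\in\mathbb T$ and its inverse is bounded on $\mathbb T$. Let $\Phi_{\mathcal A}(t,s)$, $t\ge s$, be the fundamental matrix: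 $\Phi_{\mathcal A}^\Delta(t,s)=\mathcal A(t)\Phi_{\mathcal A}(t,s)$ (derivative in $t$), $\Phi_{\mathcal A}(s,s)=E_n$. For rd-continuous $u:\mathbb T_0^+\to\mathbb R$ with $1+\mu u>0$ put $e_u(t,s)=\exp\int_s^t\xi_{\mu(\tau)}(u(\tau))\,\Delta\tau$, where $\xi_h(z)=\log(1+hz)/h$ for $h\ne0$ and $\xi_0(z)=z$. Call $u$ an upper function if there is $C>0$ with $|\Phi_{\mathcal A}(t,s)|\le C e_u(t,s)$ for all $t\ge s$ in $\mathbb T_0^+$. The central upper exponent is $$\chi(\mathcal A)=\inf_u\ \limsup_{\mathbb T\ni t\to\infty}\frac1t\log e_u(t,0)=\inf_u\ \limsup_{\mathbb T\ni t\to\infty}\frac1t\int_0^t\xi_{\mu(\tau)}(u(\tau))\,\Delta\tau\in[-\infty,\infty],$$ the infimum being over all upper functions $u$. Theorem. If $\chi(\mathcal A)>0$, then for every $\delta>0$ there is an rd-continuous $\mathcal B_\delta:\mathbb T\to M_n(\mathbb K)$ with $\sup_{t\in\mathbb T}|\mathcal B_\delta(t)|\le\delta$ such that $\mathcal A+\mathcal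 B_\delta$ is regressive (i.e. $E_n+\mu(t)(\mathcal A(t)+\mathcal B_\delta(t))$ is invertible for all $t\in\mathbb T$) and the system $x^\Delta=(\mathcal A(t)+\mathcal B_\delta(t))x$ is unstable. Here a linear system is stable if for every $t_0\in\mathbb T$ and $\varepsilon>0$ there is $\eta>0$ such that every solution $x$ on $\mathbb T_{t_0}^+$ with $|x(t_0)|<\eta$ satisfies $|x(t)|<\varepsilon$ for all $t\in\mathbb T_{t_0}^+$, and unstable otherwise. -/

import Mathlib

open Set Filter Topology

noncomputable section

namespace TimeScale

/-- A time scale: a closed subset of `ℝ`, containing `0` and unbounded above. -/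
structure IsTimeScale (T : Set ℝ) : Prop where
  isClosed : IsClosed T
  zero_mem : (0 : ℝ) ∈ T
  not_bddAbove : ¬ BddAbove T

/-- The forward part `[a, ∞) ∩ T`. -/
def fwd (T : Set ℝ) (a : ℝ) : Set ℝ := T ∩ Ici a

/-- The forward jump operator `σ(t) = inf {s ∈ T : s > t}`. -/
def sigma (T : Set ℝ) (t : ℝ) : ℝ := sInf {s | s ∈ T ∧ t < s}

/-- The graininess `μ(t) = σ(t) - t`. -/
def mu (T : Set ℝ) (t : ℝ) : ℝ := sigma T t - t

def RightDense (T : Set ℝ) (t : ℝ) : Prop := sigma T t = t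

/-- `t` is a limit of points of `T` lying strictly to its left. -/
def LeftDense (T : Set ℝ) (t : ℝ) : Prop := t ∈ closure (T ∩ Iio t)

section calculus

variable {F : Type*} [NormedAddCommGroup F] [NormedSpace ℝ F]

/-- rd-continuity on `T`. Functions on `T` are represented by functions on `ℝ` of which only
the values at points of `T` matter. -/
def RdContinuous (T : Set ℝ) (f : ℝ → F) : Prop :=
  (∀ t ∈ T, RightDense T t → ContinuousWithinAt f T t) ∧
  (∀ t ∈ T, LeftDense T t → ∃ l : F, Tendsto f (𝓝[T ∩ Iio t] t) (𝓝 l))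

/-- `f` is `Δ`-differentiable at `t` with `f^Δ(t) = γ`. -/
def HasDeltaDerivAt (T : Set ℝ) (f : ℝ → F) (γ : F) (t : ℝ) : Prop :=
  ∀ ε > 0, ∀ᶠ s in 𝓝[T] t,
    ‖(f (sigma T t) - f s) - (sigma T t - s) • γ‖ ≤ ε * |sigma T t - s|

/-- `G` is a `Δ`-antiderivative of `g` on `T`. -/
def IsAntiderivative (T : Set ℝ) (G g : ℝ → F) : Prop :=
  ∀ t ∈ T, HasDeltaDerivAt T G (g t) t

open Classical in
/-- The Cauchy `Δ`-integral `∫_a^b g(τ) Δτ = G(b) - G(a)`, with `G` a `Δ`-antiderivative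
of `g` on `T` (and the value `0` if there is none). -/
def deltaIntegral (T : Set ℝ) (g : ℝ → F) (a b : ℝ) : F :=
  if h : ∃ G : ℝ → F, IsAntiderivative T G g then h.choose b - h.choose a else 0

end calculus

/-- The cylinder transformation, used for real `z` with `1 + h z > 0`. -/
def cylinder (h z : ℝ) : ℝ := if h = 0 then z else Real.log (1 + z * h) / h

def PositivelyRegressive (T : Set ℝ) (p : ℝ → ℝ) : Prop :=
  ∀ t ∈ T, 0 < 1 + mu T t * p t

/-- The generalized exponential function `e_p(t, s)` of a positively regressive `p`. -/
def genExp (T : Set ℝ) (p : ℝ → ℝ) (t s : ℝ) : ℝ :=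
  Real.exp (deltaIntegral T (fun τ => cylinder (mu T τ) (p τ)) s t)

/-- `𝕜ⁿ` with the Euclidean norm. -/
abbrev Vec (𝕜 : Type*) [RCLike 𝕜] (n : ℕ) : Type _ := EuclideanSpace 𝕜 (Fin n)

/-- `n × n` matrices over `𝕜`, as linear operators on `𝕜ⁿ`, with the operator norm. -/
abbrev Mat (𝕜 : Type*) [RCLike 𝕜] (n : ℕ) : Type _ := Vec 𝕜 n →L[𝕜] Vec 𝕜 n

section systems

variable {𝕜 : Type*} [RCLike 𝕜] {n : ℕ}

def BoundedOn (T : Set ℝ) (A : ℝ → Mat 𝕜 n) : Prop :=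
  ∃ a : ℝ, ∀ t ∈ T, ‖A t‖ ≤ a

/-- `E + μ(t) A(t)` is invertible for every `t ∈ T`. -/
def Regressive (T : Set ℝ) (A : ℝ → Mat 𝕜 n) : Prop :=
  ∀ t ∈ T, IsUnit (1 + mu T t • A t)

/-- `A` is regressive and `(E + μ(t) A(t))⁻¹` is bounded on `T`. -/
def UniformlyRegressive (T : Set ℝ) (A : ℝ → Mat 𝕜 n) : Prop :=
  Regressive T A ∧ ∃ K : ℝ, ∀ t ∈ T, ‖Ring.inverse (1 + mu T t • A t)‖ ≤ K

/-- `Φ(t, s)`, for `s ≤ t` in `T`, is the fundamental matrix of `x^Δ = A(t) x`. -/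
def IsFundamentalMatrix (T : Set ℝ) (A : ℝ → Mat 𝕜 n) (Φ : ℝ → ℝ → Mat 𝕜 n) : Prop :=
  ∀ s ∈ T, Φ s s = 1 ∧
    ∀ t ∈ fwd T s, HasDeltaDerivAt (fwd T s) (fun r => Φ r s) (A t * Φ t s) t

/-- `x` solves `x^Δ = A(t) x` on `[t₀, ∞) ∩ T`. -/
def IsSolution (T : Set ℝ) (A : ℝ → Mat 𝕜 n) (t₀ : ℝ) (x : ℝ → Vec 𝕜 n) : Prop :=
  ∀ t ∈ fwd T t₀, HasDeltaDerivAt (fwd T t₀) x (A t (x t)) t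

/-- Stability of the system `x^Δ = A(t) x`. -/
def Stable (T : Set ℝ) (A : ℝ → Mat 𝕜 n) : Prop :=
  ∀ t₀ ∈ T, ∀ ε > 0, ∃ δ > 0, ∀ x : ℝ → Vec 𝕜 n, IsSolution T A t₀ x →
    ‖x t₀‖ < δ → ∀ t ∈ fwd T t₀, ‖x t‖ < ε

/-- `u` is an upper function of `x^Δ = A(t) x` on `T`. Positive regressivity is forced by the
estimate itself, whose left-hand side is positive, and makes `e_u` meaningful. -/
def IsUpperFunction (T : Set ℝ) (A : ℝ → Mat 𝕜 n) (u : ℝ → ℝ) : Prop :=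
  RdContinuous T u ∧ PositivelyRegressive T u ∧
    ∃ Φ : ℝ → ℝ → Mat 𝕜 n, IsFundamentalMatrix T A Φ ∧
      ∃ C > 0, ∀ s ∈ T, ∀ t ∈ T, s ≤ t → ‖Φ t s‖ ≤ C * genExp T u t s

/-- `χ_u = limsup (1/t) log e_u(t, 0)`, that is, the upper mean value of `ξ_{μ(τ)}(u(τ))`,
as `t → ∞` in `T`. -/
def upperMean (T : Set ℝ) (u : ℝ → ℝ) : EReal :=
  limsup (fun t : ℝ =>
      (((1 / t) * deltaIntegral T (fun τ => cylinder (mu T τ) (u τ)) 0 t : ℝ) : EReal))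
    (atTop ⊓ 𝓟 T)

/-- The central upper exponent: the infimum of `χ_u` over the upper functions `u` on
`[0, ∞) ∩ T`. -/
def centralUpperExponent (T : Set ℝ) (A : ℝ → Mat 𝕜 n) : EReal :=
  ⨅ u ∈ {u : ℝ → ℝ | IsUpperFunction (fwd T 0) A u}, upperMean (fwd T 0) u

end systems

end TimeScale

end

noncomputable section

namespace TimeScale

/-! ### Jump operator, graininess and restriction to the half line. -/

section basics

variable {T : Set ℝ}

/-! The time scale is cut into long blocks. The norms of the transition matrix over these blocks
build an upper function, and a small perturbation makes one solution realize the same norms up to a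
fixed factor per block.

Let `S = fwd T 0`, let `Ψ` be the fundamental matrix normalized at `0`, and let `τ (i + 1)` be the
first point of `S` at or beyond `τ i + L`. Put `N i = ‖Ψ (τ (i + 1)) Ψ (τ i)⁻¹‖`.

Upper function (`IsTransition.exists_upperFunction`). A smooth `g` that gains `log (N i)` over block
`i` gives `u = expRate S g` with `e_u(t, s) = exp (g t - g s)`. Submultiplicativity over whole
blocks and bounded errors on partial blocks make `u` an upper function. So the central exponent is
at most the upper mean of `u`, and for every real `ε` below that exponent `g t > ε t` at arbitrarily
late `t`.

Perturbation (`exists_path`, `exists_perturbation_of_path`). Look for the solution as `x = Ψ z`,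
where `z` changes only during the first unit of time of each block, by a kick small relative to the
current state. By the product rule `x^Δ = A x + (1 + μ A) Ψ z^Δ`, so `B = (1 + μ A) R`, with `R` of
rank one taking `x` to `Ψ z^Δ`, turns `x` into a solution. The factorization `1 + μ (A + B) = (1 + μ
A)(1 + μ R)` reduces regressivity to `‖μ R‖ < 1`. A kick in an almost norming direction yields `‖x
(τ (i + 1))‖ ≥ η N i ‖x (τ i)‖`.

The factor `η` depends on `A` and `δ` but not on the blocks, so `L` can be chosen afterwards, so
large that the loss `η ^ i` costs at most `ε t / 2` in the exponent. Then `x` is unbounded, and by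
linearity the perturbed system is unstable.

Unbounded gaps do no harm: only the last step of a block can be long, `N i` contains it exactly, and
a kick spread across a gap has difference quotient at most `1 / μ`. -/

theorem IsTimeScale.exists_gt (hT : IsTimeScale T) (t : ℝ) : ∃ s ∈ T, t < s :=
  not_bddAbove_iff.1 hT.not_bddAbove t

theorem IsTimeScale.sigma_mem (hT : IsTimeScale T) (t : ℝ) : sigma T t ∈ T := by
  have h := csInf_mem_closure (hT.exists_gt t) ⟨t, fun s hs => hs.2.le⟩
  exact hT.isClosed.closure_subset_iff.2 (fun s hs => hs.1) h

theorem IsTimeScale.le_sigma (hT : IsTimeScale T) (t : ℝ) : t ≤ sigma T t :=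
  le_csInf (hT.exists_gt t) fun _ hs => hs.2.le

theorem sigma_le {s t : ℝ} (hs : s ∈ T) (h : t < s) : sigma T t ≤ s :=
  csInf_le ⟨t, fun _ hr => hr.2.le⟩ ⟨hs, h⟩

theorem IsTimeScale.mu_nonneg (hT : IsTimeScale T) (t : ℝ) : 0 ≤ mu T t :=
  sub_nonneg.2 (hT.le_sigma t)

theorem mu_eq_zero_iff {t : ℝ} : mu T t = 0 ↔ sigma T t = t := sub_eq_zero

theorem sigma_fwd {a t : ℝ} (h : a ≤ t) : sigma (fwd T a) t = sigma T t := by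
  unfold sigma fwd
  congr 1
  ext s
  simp only [mem_inter_iff, mem_Ici, mem_ofPred_eq]
  constructor
  · rintro ⟨⟨h1, _⟩, h2⟩
    exact ⟨h1, h2⟩
  · rintro ⟨h1, h2⟩
    exact ⟨⟨h1, h.trans h2.le⟩, h2⟩

theorem mu_fwd {a t : ℝ} (h : a ≤ t) : mu (fwd T a) t = mu T t := by
  rw [mu, mu, sigma_fwd h]

theorem IsTimeScale.fwd_zero (hT : IsTimeScale T) : IsTimeScale (fwd T 0) where
  isClosed := hT.isClosed.inter isClosed_Ici
  zero_mem := ⟨hT.zero_mem, self_mem_Ici⟩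
  not_bddAbove := by
    rw [not_bddAbove_iff]
    intro x
    obtain ⟨s, hs, h⟩ := hT.exists_gt (max x 0)
    exact ⟨s, ⟨hs, (le_max_right x 0).trans h.le⟩, (le_max_left x 0).trans_lt h⟩

theorem IsTimeScale.tendsto_sigma_of_rightDense (hT : IsTimeScale T) {t : ℝ}
    (h : sigma T t = t) : Tendsto (sigma T) (𝓝[T] t) (𝓝 t) := by
  refine tendsto_order.2 ⟨fun a ha => ?_, fun b hb => ?_⟩
  · filter_upwards [mem_nhdsWithin_of_mem_nhds (lt_mem_nhds ha)] with r hr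
    exact lt_of_lt_of_le hr (hT.le_sigma r)
  · have : sInf {s | s ∈ T ∧ t < s} < b := by
      change sigma T t < b
      rwa [h]
    obtain ⟨s, hs, hsb⟩ := exists_lt_of_csInf_lt (hT.exists_gt t) this
    filter_upwards [mem_nhdsWithin_of_mem_nhds (gt_mem_nhds hs.2)] with r hr
    exact (sigma_le hs.1 hr).trans_lt hsb

theorem IsTimeScale.tendsto_sigma_left (hT : IsTimeScale T) {t : ℝ} (ht : t ∈ T) :
    Tendsto (sigma T) (𝓝[T ∩ Iio t] t) (𝓝 t) := by
  refine tendsto_order.2 ⟨fun a ha => ?_, fun b hb => ?_⟩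
  · filter_upwards [mem_nhdsWithin_of_mem_nhds (lt_mem_nhds ha)] with r hr
    exact lt_of_lt_of_le hr (hT.le_sigma r)
  · filter_upwards [self_mem_nhdsWithin] with r hr
    exact (sigma_le ht hr.2).trans_lt hb

end basics

/-! ### Rd-continuity. -/

section rdContinuity

variable {T : Set ℝ} {E F G : Type*} [NormedAddCommGroup E] [NormedAddCommGroup F]
  [NormedAddCommGroup G]

theorem rdContinuous_of_continuousOn {f : ℝ → E} (h : ContinuousOn f T) : RdContinuous T f :=
  ⟨fun t ht _ => h t ht, fun t ht _ => ⟨f t, (h t ht).mono_left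
    (nhdsWithin_mono t inter_subset_left)⟩⟩

/-- Rd-continuity is preserved by jointly continuous binary operations. -/
theorem RdContinuous.comp₂ {f : ℝ → E} {g : ℝ → F} {φ : E → F → G}
    (hφ : Continuous fun p : E × F => φ p.1 p.2)
    (hf : RdContinuous T f) (hg : RdContinuous T g) :
    RdContinuous T fun t => φ (f t) (g t) := by
  refine ⟨fun t ht hd => ?_, fun t ht hd => ?_⟩
  · exact (hφ.tendsto (f t, g t)).comp ((hf.1 t ht hd).prodMk_nhds (hg.1 t ht hd))
  · obtain ⟨l, hl⟩ := hf.2 t ht hd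
    obtain ⟨m, hm⟩ := hg.2 t ht hd
    exact ⟨φ l m, (hφ.tendsto (l, m)).comp (hl.prodMk_nhds hm)⟩

theorem RdContinuous.fwd {f : ℝ → E} (hf : RdContinuous T f) (a : ℝ) :
    RdContinuous (fwd T a) f := by
  refine ⟨fun t ht hd => ?_, fun t ht hd => ?_⟩
  · have hd' : RightDense T t := by
      rw [RightDense, sigma_fwd ht.2] at hd
      exact hd
    exact (hf.1 t ht.1 hd').mono inter_subset_left
  · have hsub : TimeScale.fwd T a ∩ Iio t ⊆ T ∩ Iio t :=
      inter_subset_inter_left _ inter_subset_left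
    obtain ⟨l, hl⟩ := hf.2 t ht.1 (closure_mono hsub hd)
    exact ⟨l, hl.mono_left (nhdsWithin_mono t hsub)⟩

/-- Near a right-dense point, and on the left of any point of `T`, both `s` and `σ(s)` tend to `t`.
These two limits are all that the functions considered here need, so one argument serves both halves
of rd-continuity. -/
theorem IsTimeScale.rdContinuous_of_tendsto (hT : IsTimeScale T) {f : ℝ → E}
    (h₁ : ∀ t ∈ T, sigma T t = t → ∀ l : Filter ℝ, Tendsto id l (𝓝 t) →
      Tendsto (sigma T) l (𝓝 t) → Tendsto f l (𝓝 (f t)))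
    (h₂ : ∀ t ∈ T, ∃ y, ∀ l : Filter ℝ, Tendsto id l (𝓝 t) →
      Tendsto (sigma T) l (𝓝 t) → Tendsto f l (𝓝 y)) : RdContinuous T f := by
  refine ⟨fun t ht hd => ?_, fun t ht _ => ?_⟩
  · exact h₁ t ht hd _ (tendsto_id.mono_left nhdsWithin_le_nhds)
      (hT.tendsto_sigma_of_rightDense hd)
  · obtain ⟨y, hy⟩ := h₂ t ht
    exact ⟨y, hy _ (tendsto_id.mono_left nhdsWithin_le_nhds) (hT.tendsto_sigma_left ht)⟩

theorem IsTimeScale.rdContinuous_mu (hT : IsTimeScale T) : RdContinuous T (mu T) := by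
  have key : ∀ t : ℝ, ∀ l : Filter ℝ, Tendsto id l (𝓝 t) →
      Tendsto (sigma T) l (𝓝 t) → Tendsto (mu T) l (𝓝 0) := by
    intro t l h1 h2
    have := h2.sub h1
    rwa [sub_self] at this
  refine hT.rdContinuous_of_tendsto (fun t _ hd l h1 h2 => ?_) fun t _ => ⟨0, key t⟩
  rw [mu_eq_zero_iff.2 hd]
  exact key t l h1 h2

end rdContinuity

/-! ### The `Δ`-derivative, and functions that are `C¹` on the line. -/

section derivative

variable {T : Set ℝ} {E : Type*} [NormedAddCommGroup E] [NormedSpace ℝ E]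

theorem hasDeltaDerivAt_iff_hasDerivWithinAt {f : ℝ → E} {γ : E} {t : ℝ} (h : sigma T t = t) :
    HasDeltaDerivAt T f γ t ↔ HasDerivWithinAt f γ T t := by
  rw [hasDerivWithinAt_iff_isLittleO, Asymptotics.isLittleO_iff, HasDeltaDerivAt, h]
  refine forall₂_congr fun ε _ => eventually_congr (Eventually.of_forall fun s => ?_)
  rw [Real.norm_eq_abs, abs_sub_comm s t, ← norm_neg (f s - f t - _)]
  have : -(f s - f t - (s - t) • γ) = f t - f s - (t - s) • γ := by module
  rw [this]

/-- At a right-scattered point `|σ(t) - s|` tends to `μ(t) > 0`, so the defining inequality says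
that its left side tends to `0`; taking `s = t` gives the jump relation and the rest is continuity.
-/
theorem hasDeltaDerivAt_iff_of_lt {f : ℝ → E} {γ : E} {t : ℝ} (ht : t ∈ T)
    (h : t < sigma T t) :
    HasDeltaDerivAt T f γ t ↔
      ContinuousWithinAt f T t ∧ f (sigma T t) = f t + mu T t • γ := by
  have hμ : 0 < mu T t := sub_pos.2 h
  have habs : Tendsto (fun s => |sigma T t - s|) (𝓝[T] t) (𝓝 (mu T t)) := by
    have : ContinuousWithinAt (fun s : ℝ => |sigma T t - s|) T t :=
      (by fun_prop : Continuous fun s : ℝ => |sigma T t - s|).continuousWithinAt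
    have h2 : |sigma T t - t| = mu T t := abs_of_pos hμ
    rw [← h2]
    exact this
  constructor
  · intro H
    have hjump : f (sigma T t) = f t + mu T t • γ := by
      have h0 : ‖(f (sigma T t) - f t) - mu T t • γ‖ ≤ 0 := by
        refine le_of_forall_pos_le_add fun ε hε => ?_
        have := (H (ε / mu T t) (div_pos hε hμ)).self_of_nhdsWithin ht
        rw [abs_of_pos (sub_pos.2 h)] at this
        change ‖(f (sigma T t) - f t) - mu T t • γ‖ ≤ ε / mu T t * mu T t at this
        rw [div_mul_cancel₀ _ hμ.ne'] at this
        linarith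
      have := norm_le_zero_iff.1 h0
      rw [sub_eq_zero] at this
      rw [← this]
      abel
    refine ⟨?_, hjump⟩
    have he : Tendsto (fun s => (f (sigma T t) - f s) - (sigma T t - s) • γ) (𝓝[T] t) (𝓝 0) := by
      rw [Metric.tendsto_nhds]
      intro ε hε
      filter_upwards [H (ε / (2 * mu T t)) (by positivity),
        habs.eventually (gt_mem_nhds (by linarith : mu T t < 2 * mu T t))] with s hs hs2
      rw [dist_zero_right]
      calc _ ≤ ε / (2 * mu T t) * |sigma T t - s| := hs
        _ < ε / (2 * mu T t) * (2 * mu T t) := by gcongr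
        _ = ε := by field_simp
    have h3 : Tendsto (fun s => f (sigma T t) - (sigma T t - s) • γ
        - ((f (sigma T t) - f s) - (sigma T t - s) • γ)) (𝓝[T] t)
        (𝓝 (f (sigma T t) - (sigma T t - t) • γ - 0)) := by
      refine Tendsto.sub ?_ he
      exact (by fun_prop : Continuous fun s : ℝ =>
        f (sigma T t) - (sigma T t - s) • γ).continuousWithinAt
    have h4 : f (sigma T t) - (sigma T t - t) • γ - 0 = f t := by
      rw [hjump, mu]
      module
    rw [h4] at h3
    refine h3.congr fun s => ?_
    module
  · rintro ⟨hc, hjump⟩ ε hε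
    have he : Tendsto (fun s => (f (sigma T t) - f s) - (sigma T t - s) • γ) (𝓝[T] t) (𝓝 0) := by
      have h4 : (f (sigma T t) - f t) - (sigma T t - t) • γ = 0 := by
        rw [hjump, mu]
        module
      rw [← h4]
      refine (tendsto_const_nhds.sub hc).sub ?_
      exact (by fun_prop : Continuous fun s : ℝ => (sigma T t - s) • γ).continuousWithinAt
    rw [Metric.tendsto_nhds] at he
    filter_upwards [he (ε * (mu T t / 2)) (by positivity),
      habs.eventually (lt_mem_nhds (by linarith : mu T t / 2 < mu T t))] with s hs hs2
    rw [dist_zero_right] at hs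
    calc _ ≤ ε * (mu T t / 2) := hs.le
      _ ≤ _ := by gcongr

theorem IsTimeScale.hasDeltaDerivAt_jump (hT : IsTimeScale T) {f : ℝ → E} {γ : E} {t : ℝ}
    (ht : t ∈ T) (hf : HasDeltaDerivAt T f γ t) : f (sigma T t) = f t + mu T t • γ := by
  rcases (hT.le_sigma t).eq_or_lt with h | h
  · rw [mu_eq_zero_iff.2 h.symm, ← h, zero_smul, add_zero]
  · exact ((hasDeltaDerivAt_iff_of_lt ht h).1 hf).2

theorem IsTimeScale.hasDeltaDerivAt_continuousWithinAt (hT : IsTimeScale T) {f : ℝ → E} {γ : E}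
    {t : ℝ} (ht : t ∈ T) (hf : HasDeltaDerivAt T f γ t) : ContinuousWithinAt f T t := by
  rcases (hT.le_sigma t).eq_or_lt with h | h
  · exact ((hasDeltaDerivAt_iff_hasDerivWithinAt h.symm).1 hf).continuousWithinAt
  · exact ((hasDeltaDerivAt_iff_of_lt ht h).1 hf).1

theorem HasDeltaDerivAt.fwd {f : ℝ → E} {γ : E} {a t : ℝ} (h : a ≤ t)
    (hf : HasDeltaDerivAt T f γ t) : HasDeltaDerivAt (fwd T a) f γ t := by
  intro ε hε
  rw [sigma_fwd h]
  exact (hf ε hε).filter_mono (nhdsWithin_mono t inter_subset_left)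

/-- The `Δ`-derivative of a `C¹` function on the line. -/
def deltaQuot (T : Set ℝ) (z : ℝ → E) (t : ℝ) : E :=
  if mu T t = 0 then deriv z t else (mu T t)⁻¹ • (z (sigma T t) - z t)

theorem mu_smul_deltaQuot (z : ℝ → E) (t : ℝ) :
    mu T t • deltaQuot T z t = z (sigma T t) - z t := by
  unfold deltaQuot
  split_ifs with h
  · rw [h, mu_eq_zero_iff.1 h, zero_smul, sub_self]
  · rw [smul_inv_smul₀ h]

theorem deltaQuot_fwd {a t : ℝ} (h : a ≤ t) (z : ℝ → E) :
    deltaQuot (fwd T a) z t = deltaQuot T z t := by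
  rw [deltaQuot, deltaQuot, mu_fwd h, sigma_fwd h]

theorem IsTimeScale.hasDeltaDerivAt_deltaQuot (hT : IsTimeScale T) {z : ℝ → E} {t : ℝ}
    (ht : t ∈ T) (hz : DifferentiableAt ℝ z t) :
    HasDeltaDerivAt T z (deltaQuot T z t) t := by
  rcases (hT.le_sigma t).eq_or_lt with h | h
  · rw [hasDeltaDerivAt_iff_hasDerivWithinAt h.symm, deltaQuot, if_pos (mu_eq_zero_iff.2 h.symm)]
    exact hz.hasDerivAt.hasDerivWithinAt
  · rw [hasDeltaDerivAt_iff_of_lt ht h, mu_smul_deltaQuot]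
    exact ⟨hz.continuousAt.continuousWithinAt, by abel⟩

/-- Both ends `s` and `σ(s)` of the difference quotient move towards `t`, which is why strict
differentiability is needed. Points with `μ = 0` are covered by continuity of the derivative. -/
theorem tendsto_deltaQuot {z : ℝ → E} (hz : ContDiff ℝ 1 z) {t : ℝ} {l : Filter ℝ}
    (h₁ : Tendsto id l (𝓝 t)) (h₂ : Tendsto (sigma T) l (𝓝 t)) :
    Tendsto (deltaQuot T z) l (𝓝 (deriv z t)) := by
  have hs : HasStrictDerivAt z (deriv z t) t :=
    hz.contDiffAt.hasStrictDerivAt (by norm_num)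
  have ho := hs.hasStrictFDerivAt.isLittleO
  have hd : Tendsto (fun s => deriv z s) l (𝓝 (deriv z t)) :=
    ((hz.continuous_deriv le_rfl).tendsto t).comp h₁
  rw [Metric.tendsto_nhds] at hd ⊢
  intro ε hε
  have hp : Tendsto (fun s => (sigma T s, s)) l (𝓝 (t, t)) := h₂.prodMk_nhds h₁
  have h3 := hp.eventually (Asymptotics.isLittleO_iff.1 ho (half_pos hε))
  filter_upwards [hd ε hε, h3] with s hs1 hs2
  unfold deltaQuot
  split_ifs with h
  · exact hs1
  · rw [dist_eq_norm]
    have h4 : (mu T s)⁻¹ • (z (sigma T s) - z s) - deriv z t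
        = (mu T s)⁻¹ • (z (sigma T s) - z s - (sigma T s - s) • deriv z t) := by
      rw [smul_sub _ (z (sigma T s) - z s), ← mu, inv_smul_smul₀ h]
    rw [h4, norm_smul, norm_inv]
    have h5 : 0 < ‖mu T s‖ := norm_pos_iff.2 h
    have h6 : ‖z (sigma T s) - z s - (sigma T s - s) • deriv z t‖ ≤ ε / 2 * ‖mu T s‖ := by
      simpa [mul_comm, mu] using hs2
    calc ‖mu T s‖⁻¹ * _ ≤ ‖mu T s‖⁻¹ * (ε / 2 * ‖mu T s‖) := by gcongr
      _ = ε / 2 := by field_simp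
      _ < ε := half_lt_self hε

theorem IsTimeScale.rdContinuous_deltaQuot (hT : IsTimeScale T) {z : ℝ → E}
    (hz : ContDiff ℝ 1 z) : RdContinuous T (deltaQuot T z) := by
  refine hT.rdContinuous_of_tendsto (fun t _ hd l h1 h2 => ?_)
    fun t _ => ⟨deriv z t, fun l h1 h2 => tendsto_deltaQuot hz h1 h2⟩
  have : deltaQuot T z t = deriv z t := if_pos (mu_eq_zero_iff.2 hd)
  rw [this]
  exact tendsto_deltaQuot hz h1 h2

end derivative

/-! ### The backward projection `rho` of the line onto a time scale in `[0, ∞)`. -/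

section floor

/-- The last point of `S` before `r`. -/
def rho (S : Set ℝ) (r : ℝ) : ℝ := sSup (S ∩ Iic r)

variable {S : Set ℝ}

theorem le_rho {s r : ℝ} (hs : s ∈ S) (h : s ≤ r) : s ≤ rho S r :=
  le_csSup ⟨r, fun _ hx => hx.2⟩ ⟨hs, h⟩

theorem rho_self {s : ℝ} (hs : s ∈ S) : rho S s = s :=
  le_antisymm (csSup_le ⟨s, hs, self_mem_Iic⟩ fun _ hx => hx.2) (le_rho hs le_rfl)

variable (hS : IsTimeScale S)
include hS

theorem rho_le {r : ℝ} (hr : 0 ≤ r) : rho S r ≤ r :=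
  csSup_le ⟨0, hS.zero_mem, hr⟩ fun _ hx => hx.2

theorem lt_sigma_rho {r : ℝ} (h : sigma S (rho S r) ≠ rho S r) :
    r < sigma S (rho S r) := by
  by_contra! hle
  have := le_rho (hS.sigma_mem (rho S r)) hle
  exact h (le_antisymm this (hS.le_sigma _))

theorem rho_eq_self_of_rightDense {r : ℝ} (hr : 0 ≤ r) (h : sigma S (rho S r) = rho S r) :
    rho S r = r := by
  refine le_antisymm (rho_le hS hr) ?_
  by_contra! hlt
  have h1 : sInf {s | s ∈ S ∧ rho S r < s} < r := by
    change sigma S (rho S r) < r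
    rwa [h]
  obtain ⟨s, hs, hsr⟩ := exists_lt_of_csInf_lt (hS.exists_gt _) h1
  linarith [le_rho hs.1 hsr.le, hs.2]

variable (h0 : ∀ t ∈ S, 0 ≤ t)
include h0

/-- For `r < 0` the supremum is over the empty set, and its default value `0` is the least point of
`S`; hence `rho S` is monotone with values in `S` on the whole line. -/
theorem rho_of_nonpos {r : ℝ} (hr : r ≤ 0) : rho S r = 0 := by
  rcases hr.eq_or_lt with h | h
  · rw [h, rho_self hS.zero_mem]
  · have : S ∩ Iic r = ∅ := by
      ext s
      simp only [mem_inter_iff, mem_Iic, mem_empty_iff_false, iff_false, not_and, not_le]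
      exact fun hs => h.trans_le (h0 s hs)
    rw [rho, this, Real.sSup_empty]

theorem rho_mem (r : ℝ) : rho S r ∈ S := by
  rcases le_total r 0 with h | h
  · rw [rho_of_nonpos hS h0 h]
    exact hS.zero_mem
  · have := csSup_mem_closure (s := S ∩ Iic r) ⟨0, hS.zero_mem, h⟩ ⟨r, fun _ hx => hx.2⟩
    exact hS.isClosed.closure_subset_iff.2 inter_subset_left this

theorem max_rho_le (r : ℝ) : max (rho S r) 0 ≤ max r 0 := by
  rcases le_total r 0 with h | h
  · rw [rho_of_nonpos hS h0 h, max_self]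
    exact le_max_right _ _
  · exact max_le_max (rho_le hS h) le_rfl

theorem rho_monotone : Monotone (rho S) := by
  intro r s h
  rcases le_total r 0 with hr | hr
  · rw [rho_of_nonpos hS h0 hr]
    exact h0 _ (rho_mem hS h0 s)
  · exact le_rho (rho_mem hS h0 r) ((rho_le hS hr).trans h)

theorem rho_eq_of_lt_sigma {t r : ℝ} (ht : t ∈ S) (h1 : t ≤ r) (h2 : r < sigma S t) :
    rho S r = t := by
  refine le_antisymm ?_ (le_rho ht h1)
  by_contra! h
  have := sigma_le (rho_mem hS h0 r) h
  linarith [rho_le hS ((h0 t ht).trans h1)]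

/-- A function on `S` that is continuous at right-dense points becomes right-continuous when it
is extended to be constant on the gaps. -/
theorem continuousWithinAt_comp_rho {E : Type*} [TopologicalSpace E] {f : ℝ → E}
    (hf : ∀ t ∈ S, sigma S t = t → ContinuousWithinAt f S t) (r : ℝ) :
    ContinuousWithinAt (fun x => f (rho S x)) (Ici r) r := by
  rcases lt_or_ge r 0 with hr | hr
  · have : (fun x => f (rho S x)) =ᶠ[𝓝 r] fun _ => f 0 := by
      filter_upwards [gt_mem_nhds hr] with x hx
      rw [rho_of_nonpos hS h0 hx.le]
    exact (continuousAt_const.congr this.symm).continuousWithinAt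
  · by_cases h : sigma S (rho S r) = rho S r
    · have hrr := rho_eq_self_of_rightDense hS hr h
      have hrS : r ∈ S := hrr ▸ rho_mem hS h0 r
      rw [hrr] at h
      have h1 : Tendsto (rho S) (𝓝[Ici r] r) (𝓝[S] r) := by
        refine tendsto_nhdsWithin_iff.2 ⟨?_, Eventually.of_forall fun x => rho_mem hS h0 x⟩
        refine tendsto_of_tendsto_of_tendsto_of_le_of_le' tendsto_const_nhds
          (tendsto_id.mono_left nhdsWithin_le_nhds) ?_ ?_
        · filter_upwards [self_mem_nhdsWithin] with x hx
          exact le_rho hrS hx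
        · filter_upwards [self_mem_nhdsWithin] with x hx
          exact rho_le hS (hr.trans hx)
      have h2 := (hf r hrS h).tendsto.comp h1
      rw [ContinuousWithinAt, hrr]
      exact h2
    · have h1 := lt_sigma_rho hS h
      have : (fun x => f (rho S x)) =ᶠ[𝓝[Ici r] r] fun _ => f (rho S r) := by
        filter_upwards [mem_nhdsWithin_of_mem_nhds (gt_mem_nhds h1), self_mem_nhdsWithin]
          with x hx hx2
        rw [rho_eq_of_lt_sigma hS h0 (rho_mem hS h0 r) ((rho_le hS hr).trans hx2) hx]
      exact continuousWithinAt_const.congr_of_eventuallyEq this rfl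

theorem rho_mem_uIcc {s t r : ℝ} (hs : s ∈ S) (ht : t ∈ S) (hr : r ∈ uIcc s t) :
    rho S r ∈ uIcc s t := by
  rw [mem_uIcc] at hr ⊢
  rcases hr with ⟨h1, h2⟩ | ⟨h1, h2⟩
  · exact Or.inl ⟨le_rho hs h1, (rho_le hS ((h0 s hs).trans h1)).trans h2⟩
  · exact Or.inr ⟨le_rho ht h1, (rho_le hS ((h0 t ht).trans h1)).trans h2⟩

end floor

open MeasureTheory in
-- The function is the pointwise limit of step functions that sample it at the next grid point to
-- the right of `r` on a grid of mesh `1 / (n + 1)`.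
theorem stronglyMeasurable_of_rightContinuous {E : Type*} [TopologicalSpace E]
    [TopologicalSpace.PseudoMetrizableSpace E] {f : ℝ → E}
    (hf : ∀ r, ContinuousWithinAt f (Ici r) r) : StronglyMeasurable f := by
  refine stronglyMeasurable_of_tendsto (u := atTop)
    (f := fun (n : ℕ) (r : ℝ) => f ((⌊((n : ℝ) + 1) * r⌋ + 1) / ((n : ℝ) + 1))) ?_ ?_
  · intro n
    have h1 : StronglyMeasurable fun k : ℤ => f (((k : ℝ) + 1) / ((n : ℝ) + 1)) :=
      StronglyMeasurable.of_discrete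
    exact h1.comp_measurable (Int.measurable_floor.comp (measurable_const_mul _))
  · refine tendsto_pi_nhds.2 fun r => ?_
    refine (hf r).tendsto.comp (tendsto_nhdsWithin_iff.2 ⟨?_, Eventually.of_forall fun n => ?_⟩)
    · have h2 : Tendsto (fun n : ℕ => r + 1 / ((n : ℝ) + 1)) atTop (𝓝 (r + 0)) :=
        tendsto_const_nhds.add tendsto_one_div_add_atTop_nhds_zero_nat
      rw [add_zero] at h2
      refine tendsto_of_tendsto_of_tendsto_of_le_of_le tendsto_const_nhds h2 ?_ ?_
      · intro n
        have hn : (0 : ℝ) < (n : ℝ) + 1 := by positivity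
        change r ≤ _ / _
        rw [le_div_iff₀ hn]
        linarith [Int.lt_floor_add_one (((n : ℝ) + 1) * r)]
      · intro n
        have hn : (0 : ℝ) < (n : ℝ) + 1 := by positivity
        change _ / _ ≤ r + 1 / ((n : ℝ) + 1)
        have h3 : (r + 1 / ((n : ℝ) + 1)) * ((n : ℝ) + 1) = ((n : ℝ) + 1) * r + 1 := by field_simp
        rw [div_le_iff₀ hn, h3]
        linarith [Int.floor_le (((n : ℝ) + 1) * r)]
    · have hn : (0 : ℝ) < (n : ℝ) + 1 := by positivity
      change r ≤ _ / _
      rw [le_div_iff₀ hn]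
      linarith [Int.lt_floor_add_one (((n : ℝ) + 1) * r)]

/-! ### Antiderivatives and their uniqueness up to constants. -/

section antiderivative

variable {S : Set ℝ} {E : Type*} [NormedAddCommGroup E] [NormedSpace ℝ E]

open MeasureTheory in
/-- Integrating the extension of a function that is constant on the gaps gives an
antiderivative. -/
theorem isAntiderivative_integral_rho [CompleteSpace E] (hS : IsTimeScale S)
    (h0 : ∀ t ∈ S, 0 ≤ t) {f G : ℝ → E}
    (hf : ∀ t ∈ S, sigma S t = t → ContinuousWithinAt f S t)
    (hfi : ∀ b, IntervalIntegrable (fun r => f (rho S r)) volume 0 b)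
    (hG : ∀ s ∈ S, ∀ t ∈ S, G t - G s = ∫ r in s..t, f (rho S r)) (hGc : ContinuousOn G S) :
    IsAntiderivative S G f := by
  intro t ht
  rcases (hS.le_sigma t).eq_or_lt with h | h
  · intro ε hε
    rw [← h]
    have hc := hf t ht h.symm
    rw [Metric.continuousWithinAt_iff] at hc
    obtain ⟨δ, hδ, hc⟩ := hc ε hε
    filter_upwards [self_mem_nhdsWithin, mem_nhdsWithin_of_mem_nhds (Metric.ball_mem_nhds t hδ)]
      with s hs hst
    have hI : IntervalIntegrable (fun r => f (rho S r)) volume s t :=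
      (hfi s).symm.trans (hfi t)
    rw [hG s hs t ht, ← intervalIntegral.integral_const, ← intervalIntegral.integral_sub hI
      intervalIntegrable_const]
    refine intervalIntegral.norm_integral_le_of_norm_le_const fun r hr => ?_
    have hr' := rho_mem_uIcc hS h0 hs ht (uIoc_subset_uIcc hr)
    have h3 : dist (rho S r) t < δ := by
      refine lt_of_le_of_lt ?_ hst
      rw [Real.dist_eq, Real.dist_eq, abs_sub_comm _ t, abs_sub_comm s t]
      exact abs_sub_right_of_mem_uIcc hr'
    have := hc (rho_mem hS h0 r) h3
    rw [dist_eq_norm] at this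
    exact this.le
  · rw [hasDeltaDerivAt_iff_of_lt ht h]
    refine ⟨hGc t ht, ?_⟩
    have h1 : ∫ r in t..sigma S t, f (rho S r) = mu S t • f t := by
      have : ∫ r in t..sigma S t, f (rho S r) = ∫ r in t..sigma S t, f t := by
        refine intervalIntegral.integral_congr_ae ?_
        -- On the gap the extension equals `f t` except possibly at the right endpoint.
        have hne : ∀ᵐ r : ℝ, r ≠ sigma S t := by
          simp [ae_iff]
        filter_upwards [hne] with r hr hr2
        rw [uIoc_of_le h.le] at hr2
        rw [rho_eq_of_lt_sigma hS h0 ht hr2.1.le (lt_of_le_of_ne hr2.2 hr)]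
      rw [this, intervalIntegral.integral_const, mu]
    rw [← h1, ← hG t ht _ (hS.sigma_mem t)]
    abel

/-- A function with vanishing `Δ`-derivative is constant. -/
theorem eq_of_isAntiderivative_zero (hS : IsTimeScale S) (h0 : ∀ t ∈ S, 0 ≤ t) {D : ℝ → E}
    (hD : IsAntiderivative S D fun _ => 0) {t : ℝ} (ht : t ∈ S) : D t = D 0 := by
  have hjump : ∀ t ∈ S, D (sigma S t) = D t := fun t ht => by
    simpa using hS.hasDeltaDerivAt_jump ht (hD t ht)
  have hcont : ∀ t ∈ S, ContinuousWithinAt D S t := fun t ht =>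
    hS.hasDeltaDerivAt_continuousWithinAt ht (hD t ht)
  -- `D ∘ rho S` is constant on gaps and has zero right derivative everywhere; once it is also left
  -- continuous, the mean value theorem for right derivatives applies.
  have hright : ∀ r, 0 ≤ r → HasDerivWithinAt (fun x => D (rho S x)) 0 (Ici r) r := by
    intro r hr
    by_cases h : sigma S (rho S r) = rho S r
    · have hrr := rho_eq_self_of_rightDense hS hr h
      have hrS : r ∈ S := hrr ▸ rho_mem hS h0 r
      rw [hrr] at h
      have h1 := (hasDeltaDerivAt_iff_hasDerivWithinAt h).1 (hD r hrS)
      rw [hasDerivWithinAt_iff_isLittleO, Asymptotics.isLittleO_iff] at h1 ⊢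
      intro ε hε
      have h2 := h1 hε
      have h3 : Tendsto (rho S) (𝓝[Ici r] r) (𝓝[S] r) := by
        refine tendsto_nhdsWithin_iff.2 ⟨?_, Eventually.of_forall fun x => rho_mem hS h0 x⟩
        refine tendsto_of_tendsto_of_tendsto_of_le_of_le' tendsto_const_nhds
          (tendsto_id.mono_left nhdsWithin_le_nhds) ?_ ?_
        · filter_upwards [self_mem_nhdsWithin] with x hx
          exact le_rho hrS hx
        · filter_upwards [self_mem_nhdsWithin] with x hx
          exact rho_le hS (hr.trans hx)
      filter_upwards [h3.eventually h2, self_mem_nhdsWithin] with x hx hx2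
      rw [hrr]
      simp only [smul_zero, sub_zero] at hx ⊢
      refine hx.trans (mul_le_mul_of_nonneg_left ?_ hε.le)
      have h4 := le_rho hrS hx2
      have h5 := rho_le hS (hr.trans hx2)
      rw [Real.norm_of_nonneg (sub_nonneg.2 h4), Real.norm_of_nonneg (sub_nonneg.2 hx2)]
      linarith
    · have h1 := lt_sigma_rho hS h
      have : (fun x => D (rho S x)) =ᶠ[𝓝[Ici r] r] fun _ => D (rho S r) := by
        filter_upwards [mem_nhdsWithin_of_mem_nhds (gt_mem_nhds h1), self_mem_nhdsWithin]
          with x hx hx2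
        rw [rho_eq_of_lt_sigma hS h0 (rho_mem hS h0 r) ((rho_le hS hr).trans hx2) hx]
      exact (hasDerivWithinAt_const _ _ _).congr_of_eventuallyEq this rfl
  have hleft : ∀ r, 0 ≤ r → ContinuousWithinAt (fun x => D (rho S x)) (Icc 0 r) r := by
    intro r hr
    have hr0 := h0 _ (rho_mem hS h0 r)
    rcases (rho_le hS hr).eq_or_lt with h | h
    · have hrS : r ∈ S := h ▸ rho_mem hS h0 r
      by_cases hd : LeftDense S r
      · have h3 : Tendsto (rho S) (𝓝[Icc 0 r] r) (𝓝[S] r) := by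
          refine tendsto_nhdsWithin_iff.2 ⟨?_, Eventually.of_forall fun x => rho_mem hS h0 x⟩
          refine tendsto_order.2 ⟨fun a ha => ?_, fun b hb => ?_⟩
          · obtain ⟨s, hs1, hs⟩ := mem_closure_iff_nhds.1 hd _ (lt_mem_nhds ha)
            filter_upwards [mem_nhdsWithin_of_mem_nhds (lt_mem_nhds hs.2)] with x hx
            exact lt_of_lt_of_le hs1 (le_rho hs.1 hx.le)
          · filter_upwards [self_mem_nhdsWithin] with x hx
            exact ((rho_le hS hx.1).trans hx.2).trans_lt hb
        have h2 := (hcont r hrS).tendsto.comp h3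
        rw [ContinuousWithinAt, h]
        exact h2
      · rcases hr.eq_or_lt with h00 | hpos
        · subst h00
          rw [Icc_self]
          exact continuousWithinAt_singleton
        · have hmem : (closure (S ∩ Iio r))ᶜ ∈ 𝓝 r := isClosed_closure.isOpen_compl.mem_nhds hd
          -- At a left-scattered `r > 0` the predecessor `q` satisfies `σ(q) = r`, and the jump
          -- relation makes `D` agree at `q` and `r`, so no discontinuity arises.
          obtain ⟨p, hp, hpr⟩ := exists_Ioc_subset_of_mem_nhds hmem ⟨r - 1, by linarith⟩
          set q := rho S (max p 0) with hq
          have hmp : max p 0 < r := max_lt hp hpos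
          have hqS : q ∈ S := rho_mem hS h0 _
          have hqr : q ≤ max p 0 := rho_le hS (le_max_right _ _)
          have hσ : sigma S q = r := by
            refine le_antisymm (sigma_le hrS (hqr.trans_lt hmp)) ?_
            by_contra! hlt
            have hσS := hS.sigma_mem q
            rcases lt_or_ge (max p 0) (sigma S q) with h6 | h6
            · exact hpr ⟨(le_max_left _ _).trans_lt h6, hlt.le⟩ (subset_closure ⟨hσS, hlt⟩)
            · have h7 : sigma S q = q := le_antisymm (le_rho hσS h6) (hS.le_sigma q)
              have h8 := rho_eq_self_of_rightDense hS (le_max_right p 0) h7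
              have h9 : sInf {s | s ∈ S ∧ q < s} < r := by
                change sigma S q < r
                exact hlt
              obtain ⟨s, hs, hsr⟩ := exists_lt_of_csInf_lt (hS.exists_gt _) h9
              have h10 : p < s := (le_max_left p 0).trans_lt (h8 ▸ hs.2)
              exact hpr ⟨h10, hsr.le⟩ (subset_closure ⟨hs.1, hsr⟩)
          have hDr : D r = D q := by rw [← hσ, hjump q hqS]
          have hev : (fun x => D (rho S x)) =ᶠ[𝓝[Icc 0 r] r] fun _ => D r := by
            filter_upwards [self_mem_nhdsWithin,
              mem_nhdsWithin_of_mem_nhds (lt_mem_nhds hmp)] with x hx hx2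
            rcases hx.2.eq_or_lt with h11 | h11
            · rw [h11, h]
            · rw [rho_eq_of_lt_sigma hS h0 hqS (hqr.trans hx2.le) (hσ ▸ h11), hDr]
          exact continuousWithinAt_const.congr_of_eventuallyEq hev (by rw [h])
    · have hσ : sigma S (rho S r) ≠ rho S r := fun h1 =>
        h.ne (rho_eq_self_of_rightDense hS hr h1)
      have h1 := lt_sigma_rho hS hσ
      have : (fun x => D (rho S x)) =ᶠ[𝓝[Icc 0 r] r] fun _ => D (rho S r) := by
        filter_upwards [mem_nhdsWithin_of_mem_nhds (lt_mem_nhds h), self_mem_nhdsWithin]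
          with x hx hx2
        rw [rho_eq_of_lt_sigma hS h0 (rho_mem hS h0 r) hx.le (hx2.2.trans_lt h1)]
      exact continuousWithinAt_const.congr_of_eventuallyEq this rfl
  have hc : ContinuousOn (fun x => D (rho S x)) (Icc 0 t) := by
    intro r hr
    have := (hleft r hr.1).union (hright r hr.1).continuousWithinAt
    refine this.mono fun x hx => ?_
    rcases le_total x r with h | h
    · exact Or.inl ⟨hx.1, h⟩
    · exact Or.inr h
  have := constant_of_has_deriv_right_zero hc (fun x hx => hright x hx.1) t ⟨h0 t ht, le_rfl⟩
  rwa [rho_self ht, rho_self hS.zero_mem] at this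

/-- The integral is defined through an arbitrarily chosen antiderivative; its difference from `G`
has zero `Δ`-derivative and is therefore constant on `S`. -/
theorem deltaIntegral_eq (hS : IsTimeScale S) (h0 : ∀ t ∈ S, 0 ≤ t) {G g : ℝ → E}
    (hG : IsAntiderivative S G g) {s t : ℝ} (hs : s ∈ S) (ht : t ∈ S) :
    deltaIntegral S g s t = G t - G s := by
  have hex : ∃ G : ℝ → E, IsAntiderivative S G g := ⟨G, hG⟩
  rw [deltaIntegral, dif_pos hex]
  have h1 : IsAntiderivative S (fun r => hex.choose r - G r) fun _ => 0 := by
    intro r hr ε hε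
    filter_upwards [hex.choose_spec r hr (ε / 2) (half_pos hε), hG r hr (ε / 2) (half_pos hε)]
      with x hx hx2
    have : (hex.choose (sigma S r) - G (sigma S r)) - (hex.choose x - G x)
        - (sigma S r - x) • (0 : E) =
        ((hex.choose (sigma S r) - hex.choose x) - (sigma S r - x) • g r)
        - ((G (sigma S r) - G x) - (sigma S r - x) • g r) := by
      rw [smul_zero]
      abel
    rw [this]
    refine (norm_sub_le _ _).trans ?_
    linarith
  have h2 := eq_of_isAntiderivative_zero hS h0 h1 hs
  have h3 := eq_of_isAntiderivative_zero hS h0 h1 ht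
  have h4 := h3.trans h2.symm
  rw [sub_eq_sub_iff_add_eq_add] at h4 ⊢
  rw [h4]
  abel

end antiderivative

/-! ### Picard iteration for the integral equation with delayed argument. -/

section picard

open MeasureTheory

variable {R : Type*} [NormedRing R]

variable {S : Set ℝ} (hS : IsTimeScale S) (h0 : ∀ t ∈ S, 0 ≤ t) {A : ℝ → R} {a : ℝ}
  (hm : StronglyMeasurable fun r => A (rho S r)) (ha : 0 ≤ a) (hA : ∀ t ∈ S, ‖A t‖ ≤ a)
include hS h0 hm ha hA

theorem intervalIntegrable_mul_rho {X : ℝ → R} {φ : ℝ → ℝ} (hX : StronglyMeasurable X)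
    (hφ : Continuous φ) (hb : ∀ r, ‖X (rho S r)‖ ≤ φ r) (b c : ℝ) :
    IntervalIntegrable (fun r => A (rho S r) * X (rho S r)) volume b c := by
  refine IntervalIntegrable.mono_fun' (g := fun r => a * φ r)
    ((continuous_const.mul hφ).intervalIntegrable b c) ?_ ?_
  · exact (hm.mul (hX.comp_measurable (rho_monotone hS h0).measurable)).aestronglyMeasurable
  · refine Eventually.of_forall fun r => ?_
    exact (norm_mul_le _ _).trans (mul_le_mul (hA _ (rho_mem hS h0 r)) (hb r) (norm_nonneg _) ha)

variable [NormedSpace ℝ R]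

/-- The terms of the Picard series of `X(τ) = 1 + ∫₀^τ A(ρ r) X(ρ r) dr`. -/
def picard {R : Type*} [NormedRing R] [NormedSpace ℝ R] (S : Set ℝ) (A : ℝ → R) : ℕ → ℝ → R
  | 0, _ => 1
  | k + 1, τ => ∫ r in (0 : ℝ)..max τ 0, A (rho S r) * picard S A k (rho S r)

/-- The classical factorial bound survives the delay because it is monotone in time and `rho S r ≤
r` for `r ≥ 0`. -/
theorem picard_continuous_and_norm_le (k : ℕ) : Continuous (picard S A k) ∧
    ∀ τ, ‖picard S A k τ‖ ≤ ‖(1 : R)‖ * ((a * max τ 0) ^ k / k.factorial) := by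
  induction k with
  | zero =>
    refine ⟨continuous_const, fun τ => ?_⟩
    simp [picard]
  | succ k ih =>
    obtain ⟨hc, hb⟩ := ih
    have hb' : ∀ r, ‖picard S A k (rho S r)‖ ≤
        ‖(1 : R)‖ * ((a * max r 0) ^ k / k.factorial) := by
      intro r
      refine (hb _).trans ?_
      have := max_rho_le hS h0 r
      gcongr
    have hφ : Continuous fun r : ℝ => ‖(1 : R)‖ * ((a * max r 0) ^ k / k.factorial) := by
      fun_prop
    have hI := intervalIntegrable_mul_rho hS h0 hm ha hA hc.stronglyMeasurable hφ hb'
    refine ⟨?_, fun τ => ?_⟩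
    · exact (intervalIntegral.continuous_primitive hI 0).comp (continuous_id.max continuous_const)
    · have hτ : 0 ≤ max τ 0 := le_max_right _ _
      have h1 : ‖∫ r in (0 : ℝ)..max τ 0, A (rho S r) * picard S A k (rho S r)‖ ≤
          ∫ r in (0 : ℝ)..max τ 0, (‖(1 : R)‖ * a ^ (k + 1) / k.factorial) * r ^ k := by
        refine intervalIntegral.norm_integral_le_of_norm_le hτ ?_
          (Continuous.intervalIntegrable (by fun_prop) _ _)
        refine Eventually.of_forall fun r hr => ?_
        refine (norm_mul_le _ _).trans ((mul_le_mul (hA _ (rho_mem hS h0 r)) (hb' r)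
          (norm_nonneg _) ha).trans (le_of_eq ?_))
        rw [max_eq_left hr.1.le, mul_pow]
        ring
      refine h1.trans (le_of_eq ?_)
      rw [intervalIntegral.integral_const_mul, integral_pow, mul_pow, Nat.factorial_succ]
      push_cast
      have : (k.factorial : ℝ) ≠ 0 := by positivity
      field_simp
      ring

/-- Solvability of `X(τ) = 1 + ∫₀^τ A(ρ r) X(ρ r) dr`. -/
theorem exists_integral_solution [CompleteSpace R] : ∃ X : ℝ → R, Continuous X ∧
    (∀ τ ≤ 0, X τ = 1) ∧
    (∀ b c, IntervalIntegrable (fun r => A (rho S r) * X (rho S r)) volume b c) ∧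
    ∀ τ, 0 ≤ τ → X τ = 1 + ∫ r in (0 : ℝ)..τ, A (rho S r) * X (rho S r) := by
  have hP := picard_continuous_and_norm_le hS h0 hm ha hA
  have hsum : ∀ x : ℝ, Summable fun k : ℕ => ‖(1 : R)‖ * (x ^ k / k.factorial) := fun x =>
    (Real.summable_pow_div_factorial x).mul_left _
  have hps : ∀ τ, Summable fun k => picard S A k τ := fun τ =>
    Summable.of_norm_bounded (hsum (a * max τ 0)) fun k => (hP k).2 τ
  have hXb : ∀ τ, ‖∑' k, picard S A k τ‖ ≤ ‖(1 : R)‖ * Real.exp (a * max τ 0) := fun τ => by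
    have h1 : HasSum (fun k : ℕ => ‖(1 : R)‖ * ((a * max τ 0) ^ k / k.factorial))
        (‖(1 : R)‖ * Real.exp (a * max τ 0)) := by
      rw [Real.exp_eq_exp_ℝ]
      exact (NormedSpace.expSeries_div_hasSum_exp (a * max τ 0)).mul_left _
    exact tsum_of_norm_bounded h1 fun k => (hP k).2 τ
  -- Measurability of the sum suffices at this stage; continuity follows later from the integral
  -- equation.
  have hXm : StronglyMeasurable fun τ => ∑' k, picard S A k τ := by
    refine stronglyMeasurable_of_tendsto atTop
      (f := fun (N : ℕ) τ => ∑ k ∈ Finset.range N, picard S A k τ) (fun N => ?_) ?_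
    · exact (continuous_finsetSum _ fun k _ => (hP k).1).stronglyMeasurable
    · exact tendsto_pi_nhds.2 fun τ => (hps τ).hasSum.tendsto_sum_nat
  have hXb' : ∀ r, ‖∑' k, picard S A k (rho S r)‖ ≤ ‖(1 : R)‖ * Real.exp (a * max r 0) := by
    intro r
    refine (hXb _).trans ?_
    have := max_rho_le hS h0 r
    gcongr
  have hI := intervalIntegrable_mul_rho hS h0 hm ha hA hXm
    (by fun_prop : Continuous fun r : ℝ => ‖(1 : R)‖ * Real.exp (a * max r 0)) hXb'
  have heq : ∀ τ, ∑' k, picard S A k τ =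
      1 + ∫ r in (0 : ℝ)..max τ 0, A (rho S r) * ∑' k, picard S A k (rho S r) := by
    intro τ
    have hτ : 0 ≤ max τ 0 := le_max_right _ _
    rw [(hps τ).tsum_eq_zero_add]
    congr 1
    have h1 : HasSum (fun k => ∫ r in (0 : ℝ)..max τ 0, A (rho S r) * picard S A k (rho S r))
        (∫ r in (0 : ℝ)..max τ 0, A (rho S r) * ∑' k, picard S A k (rho S r)) := by
      refine intervalIntegral.hasSum_integral_of_dominated_convergence
        (fun k _ => a * (‖(1 : R)‖ * ((a * max τ 0) ^ k / k.factorial))) ?_ ?_ ?_ ?_ ?_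
      · intro k
        exact (hm.mul ((hP k).1.stronglyMeasurable.comp_measurable
          (rho_monotone hS h0).measurable)).aestronglyMeasurable
      · intro k
        refine Eventually.of_forall fun r hr => ?_
        rw [uIoc_of_le hτ] at hr
        refine (norm_mul_le _ _).trans (mul_le_mul (hA _ (rho_mem hS h0 r)) ?_
          (norm_nonneg _) ha)
        refine ((hP k).2 _).trans ?_
        have h2 : max (rho S r) 0 ≤ max τ 0 :=
          (max_rho_le hS h0 r).trans (max_le hr.2 hτ)
        gcongr
      · exact Eventually.of_forall fun r _ => (hsum _).mul_left _
      · exact intervalIntegrable_const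
      · exact Eventually.of_forall fun r _ => (hps _).hasSum.mul_left _
    exact h1.tsum_eq
  refine ⟨fun τ => ∑' k, picard S A k τ, ?_, fun τ hτ => ?_, hI, fun τ hτ => ?_⟩
  · have h1 : Continuous fun τ => 1 + ∫ r in (0 : ℝ)..max τ 0,
        A (rho S r) * ∑' k, picard S A k (rho S r) :=
      continuous_const.add ((intervalIntegral.continuous_primitive hI 0).comp
        (continuous_id.max continuous_const))
    exact h1.congr fun τ => (heq τ).symm
  · change ∑' k, picard S A k τ = 1
    rw [heq, max_eq_right hτ, intervalIntegral.integral_same, add_zero]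
  · have := heq τ
    rwa [max_eq_left hτ] at this

end picard

/-! ### A Grönwall inequality. -/

section gronwall

open MeasureTheory

/-- Grönwall's inequality for integral inequalities with the delayed argument `ρ r`. -/
theorem gronwall_rho {S : Set ℝ} (hS : IsTimeScale S) (h0 : ∀ t ∈ S, 0 ≤ t) {y : ℝ → ℝ}
    (hy : Continuous y) {a s t : ℝ} (ha : 0 ≤ a) (hs : s ∈ S) (hst : s ≤ t)
    (hfi : ∀ b c, IntervalIntegrable (fun r => y (rho S r)) volume b c)
    (hy0 : ∀ r, 0 ≤ y r)
    (hle : ∀ r, s ≤ r → y r ≤ y s + a * ∫ x in s..r, y (rho S x)) :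
    y t ≤ y s * Real.exp (a * (t - s)) := by
  set h : ℝ → ℝ := fun r => y s + a * ∫ x in s..r, y (rho S x) with hh
  -- The majorant `h` is nondecreasing, so `y (rho S r) ≤ h (rho S r) ≤ h r` removes the delay and
  -- leaves an ordinary differential inequality for `h`.
  have hmono : ∀ p q, s ≤ p → p ≤ q → h p ≤ h q := by
    intro p q hp hpq
    have h1 := intervalIntegral.integral_add_adjacent_intervals (hfi s p) (hfi p q)
    have h2 : 0 ≤ ∫ x in p..q, y (rho S x) :=
      intervalIntegral.integral_nonneg hpq fun x _ => hy0 _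
    simp only [hh]
    rw [← h1]
    nlinarith [mul_nonneg ha h2]
  have hcont : Continuous h :=
    continuous_const.add (continuous_const.mul (intervalIntegral.continuous_primitive hfi s))
  have hmeas : StronglyMeasurable fun x => y (rho S x) :=
    hy.stronglyMeasurable.comp_measurable (rho_monotone hS h0).measurable
  have hder : ∀ r ∈ Ico s t, HasDerivWithinAt h (a * y (rho S r)) (Ici r) r := by
    intro r _
    refine ((intervalIntegral.integral_hasDerivWithinAt_right (hfi s r) (t := Ioi r)
      (hmeas.stronglyMeasurableAtFilter) ?_).const_mul a).const_add _
    exact (continuousWithinAt_comp_rho hS h0 (f := y)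
      (fun u _ _ => hy.continuousWithinAt) r).mono Ioi_subset_Ici_self
  have key := le_gronwallBound_of_liminf_deriv_right_le (f := h)
    (f' := fun r => a * y (rho S r)) (δ := y s) (K := a) (ε := 0) (a := s) (b := t)
    hcont.continuousOn ?_ ?_ ?_ t ⟨hst, le_rfl⟩
  · rw [gronwallBound_ε0] at key
    exact (hle t hst).trans key
  · intro r hr r' hr'
    exact (hder r hr).liminf_right_slope_le hr'
  · simp [hh]
  · intro r hr
    rw [add_zero]
    refine mul_le_mul_of_nonneg_left ?_ ha
    have h1 := le_rho hs hr.1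
    exact (hle _ h1).trans (hmono _ _ h1 (rho_le hS ((h0 s hs).trans hr.1)))

end gronwall

/-! ### Transition matrices and their two-sided growth bounds. -/

section transition

open MeasureTheory

variable {𝕜 : Type*} [RCLike 𝕜] {n : ℕ}

/-- `Ψ` is the fundamental matrix normalized at `0`, extended continuously to the line, with
its growth and decay bounds. -/
structure IsTransition (S : Set ℝ) (A : ℝ → Mat 𝕜 n) (a : ℝ) (Ψ : ℝ → Mat 𝕜 n) : Prop where
  continuous : Continuous Ψ
  eq_one : ∀ τ ≤ 0, Ψ τ = 1
  hasDeltaDerivAt : ∀ t ∈ S, HasDeltaDerivAt S Ψ (A t * Ψ t) t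
  norm_le : ∀ s ∈ S, ∀ t ∈ S, s ≤ t → ∀ v, ‖Ψ t v‖ ≤ Real.exp (a * (t - s)) * ‖Ψ s v‖
  exists_le_norm : ∀ D : ℝ, ∃ c > 0, ∀ s ∈ S, ∀ t ∈ S, s ≤ t → t - s ≤ D →
    ∀ v, c * ‖Ψ s v‖ ≤ ‖Ψ t v‖

theorem real_smul_mul (c : ℝ) (M N : Mat 𝕜 n) : (c • M) * N = c • (M * N) := rfl

theorem norm_le_of_isUnit {M : Mat 𝕜 n} {K : ℝ} (hM : IsUnit M) (hK : ‖Ring.inverse M‖ ≤ K)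
    (v : Vec 𝕜 n) : ‖v‖ ≤ K * ‖M v‖ := by
  have h1 : (Ring.inverse M * M) v = v := by
    rw [Ring.inverse_mul_cancel _ hM]
    rfl
  calc ‖v‖ = ‖Ring.inverse M (M v)‖ := by rw [← mul_apply_eq_comp, h1]
    _ ≤ ‖Ring.inverse M‖ * ‖M v‖ := ContinuousLinearMap.le_opNorm _ _
    _ ≤ K * ‖M v‖ := by gcongr

/-- Existence comes from the integral equation and the upper bound from Grönwall. For the lower
bound, a short stretch loses at most a factor `2` because `A` is bounded, and a single jump, however
long, loses at most `K` by uniform regressivity. A time span `D` needs a bounded number of such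
pairs, whatever its starting point. -/
theorem exists_isTransition {S : Set ℝ} (hS : IsTimeScale S) (h0 : ∀ t ∈ S, 0 ≤ t)
    {A : ℝ → Mat 𝕜 n} (hA : RdContinuous S A) {a K : ℝ} (ha : 1 ≤ a) (hK : 1 ≤ K)
    (hAa : ∀ t ∈ S, ‖A t‖ ≤ a) (hreg : Regressive S A)
    (hAK : ∀ t ∈ S, ‖Ring.inverse (1 + mu S t • A t)‖ ≤ K) :
    ∃ Ψ, IsTransition S A a Ψ := by
  have ha0 : 0 ≤ a := by linarith
  have hm : StronglyMeasurable fun r => A (rho S r) :=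
    stronglyMeasurable_of_rightContinuous (continuousWithinAt_comp_rho hS h0 hA.1)
  obtain ⟨Ψ, hc, h1, hfi, heq⟩ := exists_integral_solution hS h0 hm ha0 hAa
  have hdiff : ∀ s t, 0 ≤ s → 0 ≤ t →
      Ψ t - Ψ s = ∫ r in s..t, A (rho S r) * Ψ (rho S r) := by
    intro s t hs ht
    rw [heq s hs, heq t ht, ← intervalIntegral.integral_interval_sub_left (hfi 0 t) (hfi 0 s)]
    abel
  have hder : ∀ t ∈ S, HasDeltaDerivAt S Ψ (A t * Ψ t) t := by
    refine isAntiderivative_integral_rho (f := fun t => A t * Ψ t) hS h0 ?_ (hfi 0)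
      (fun s hs t ht => hdiff s t (h0 s hs) (h0 t ht)) hc.continuousOn
    intro t ht hd
    exact (hA.1 t ht hd).mul hc.continuousWithinAt
  have hyc : ∀ v, Continuous fun r => ‖Ψ r v‖ := fun v => (hc.clm_apply continuous_const).norm
  have hyint : ∀ v b c, IntervalIntegrable (fun r => ‖Ψ (rho S r) v‖) volume b c := by
    intro v b c
    have hmono : Monotone (rho S) := rho_monotone hS h0
    obtain ⟨C, hC⟩ :=
      (isCompact_Icc (a := rho S (min b c)) (b := rho S (max b c))).exists_bound_of_continuousOn
        (hyc v).continuousOn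
    refine IntervalIntegrable.mono_fun (f := fun _ => C) (intervalIntegrable_const)
      ((hyc v).stronglyMeasurable.comp_measurable hmono.measurable).aestronglyMeasurable ?_
    refine (ae_restrict_iff' measurableSet_uIoc).2 (Eventually.of_forall fun r hr => ?_)
    have hr' := uIoc_subset_uIcc hr
    exact (hC _ ⟨hmono hr'.1, hmono hr'.2⟩).trans (le_abs_self C)
  have hincr : ∀ v s t, 0 ≤ s → s ≤ t →
      ‖Ψ t v - Ψ s v‖ ≤ a * ∫ r in s..t, ‖Ψ (rho S r) v‖ := by
    intro v s t hs hst
    rw [← sub_apply, hdiff s t hs (hs.trans hst),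
      ContinuousLinearMap.intervalIntegral_apply (hfi s t),
      ← intervalIntegral.integral_const_mul]
    refine intervalIntegral.norm_integral_le_of_norm_le hst (Eventually.of_forall fun r _ => ?_)
      ((hyint v s t).const_mul a)
    calc _ ≤ ‖A (rho S r)‖ * ‖Ψ (rho S r) v‖ := ContinuousLinearMap.le_opNorm _ _
      _ ≤ _ := by
        have := hAa _ (rho_mem hS h0 r)
        gcongr
  have hup : ∀ s ∈ S, ∀ t, s ≤ t → ∀ v, ‖Ψ t v‖ ≤ Real.exp (a * (t - s)) * ‖Ψ s v‖ := by
    intro s hs t hst v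
    rw [mul_comm]
    refine gronwall_rho hS h0 (hyc v) ha0 hs hst (hyint v) (fun _ => norm_nonneg _) ?_
    intro r hr
    have h2 := hincr v s r (h0 s hs) hr
    have h3 := norm_le_norm_add_norm_sub' (Ψ r v) (Ψ s v)
    linarith
  -- Over a time `h` the solution grows by at most `exp (1 / 8) ≤ 4`, so its increment is at most `a
  -- * h * 4 = 1 / 2` of the initial norm.
  set h : ℝ := 1 / (8 * a) with hh
  have hhpos : 0 < h := by positivity
  have hah : a * h = 1 / 8 := by
    rw [hh]
    field_simp
  have hexp : Real.exp (1 / 8) ≤ 4 := by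
    have h2 : Real.exp (1 / 8) ≤ Real.exp 1 := Real.exp_le_exp.2 (by norm_num)
    linarith [Real.exp_one_lt_d9]
  have hhalf : ∀ s ∈ S, ∀ t ∈ S, s ≤ t → t - s ≤ h → ∀ v, ‖Ψ s v‖ ≤ 2 * ‖Ψ t v‖ := by
    intro s hs t ht hst hth v
    have h2 := hincr v s t (h0 s hs) hst
    have h3 : ∫ r in s..t, ‖Ψ (rho S r) v‖ ≤ ∫ r in s..t, 4 * ‖Ψ s v‖ := by
      refine intervalIntegral.integral_mono_on hst (hyint v s t) intervalIntegrable_const ?_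
      intro r hr
      have hr1 := le_rho hs hr.1
      have hr2 := rho_le hS ((h0 s hs).trans hr.1)
      refine (hup s hs _ hr1 v).trans ?_
      have h4 : a * (rho S r - s) ≤ 1 / 8 := by
        rw [← hah]
        refine mul_le_mul_of_nonneg_left ?_ ha0
        linarith [hr.2]
      have h5 := (Real.exp_le_exp.2 h4).trans hexp
      gcongr
    rw [intervalIntegral.integral_const, smul_eq_mul] at h3
    have h4 : a * ((t - s) * (4 * ‖Ψ s v‖)) ≤ 1 / 2 * ‖Ψ s v‖ := by
      have : a * (t - s) ≤ 1 / 8 := by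
        rw [← hah]
        gcongr
      nlinarith [norm_nonneg (Ψ s v)]
    have h5 := mul_le_mul_of_nonneg_left h3 ha0
    have h6 := norm_le_norm_add_norm_sub (Ψ t v) (Ψ s v)
    linarith
  have hgap : ∀ s ∈ S, ∀ v, ‖Ψ s v‖ ≤ K * ‖Ψ (sigma S s) v‖ := by
    intro s hs v
    have h2 := hS.hasDeltaDerivAt_jump hs (hder s hs)
    have h3 : Ψ (sigma S s) v = (1 + mu S s • A s) (Ψ s v) := by
      rw [h2]
      rfl
    rw [h3]
    exact norm_le_of_isUnit (hreg s hs) (hAK s hs) _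
  have hiter : ∀ m : ℕ, ∀ s ∈ S, ∀ t ∈ S, s ≤ t → t - s ≤ m * h → ∀ v,
      ‖Ψ s v‖ ≤ (2 * K) ^ m * ‖Ψ t v‖ := by
    intro m
    induction m with
    | zero =>
      intro s _ t _ hst hts v
      have : s = t := by
        simp only [Nat.cast_zero, zero_mul] at hts
        linarith
      rw [this, pow_zero, one_mul]
    | succ m ih =>
      intro s hs t ht hst hts v
      have h2K : 1 ≤ 2 * K := by linarith
      rcases le_or_gt t (s + h) with hth | hth
      · refine (hhalf s hs t ht hst (by linarith) v).trans ?_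
        refine mul_le_mul_of_nonneg_right ?_ (norm_nonneg _)
        calc (2 : ℝ) ≤ 2 * K := by linarith
          _ ≤ (2 * K) ^ (m + 1) := le_self_pow₀ h2K (Nat.succ_ne_zero m)
      · have hsh : 0 ≤ s + h := by linarith [h0 s hs]
        -- Go to the last point `p` within time `h`, then jump to `σ(p) ≥ s + h`. The total cost is
        -- `2 * K` and at least `h` of the remaining time is used up; if `p` is right-dense then `p
        -- = s + h` already.
        set p := rho S (s + h) with hp
        have hpS : p ∈ S := rho_mem hS h0 _
        have hsp : s ≤ p := le_rho hs (by linarith)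
        have hpsh : p ≤ s + h := rho_le hS hsh
        have hq : s + h ≤ sigma S p := by
          by_cases hd : sigma S p = p
          · rw [hd]
            exact (rho_eq_self_of_rightDense hS hsh hd).ge
          · exact (lt_sigma_rho hS hd).le
        have hqt : sigma S p ≤ t := sigma_le ht (hpsh.trans_lt hth)
        have e1 := hhalf s hs p hpS hsp (by linarith) v
        have e2 := hgap p hpS v
        have e3 := ih (sigma S p) (hS.sigma_mem p) t ht hqt (by push_cast at hts; linarith) v
        calc ‖Ψ s v‖ ≤ 2 * (K * ((2 * K) ^ m * ‖Ψ t v‖)) := by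
              refine e1.trans ?_
              refine mul_le_mul_of_nonneg_left (e2.trans ?_) zero_le_two
              exact mul_le_mul_of_nonneg_left e3 (by linarith)
          _ = (2 * K) ^ (m + 1) * ‖Ψ t v‖ := by ring
  refine ⟨Ψ, hc, h1, hder, fun s hs t _ hst v => hup s hs t hst v, fun D => ?_⟩
  obtain ⟨m, hm'⟩ := exists_nat_ge (D / h)
  have hpos : 0 < (2 * K) ^ m := by positivity
  refine ⟨((2 * K) ^ m)⁻¹, inv_pos.2 hpos, fun s hs t ht hst hD v => ?_⟩
  rw [inv_mul_le_iff₀ hpos]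
  refine hiter m s hs t ht hst (hD.trans ?_) v
  rwa [div_le_iff₀ hhpos] at hm'

namespace IsTransition

variable {S : Set ℝ} {A Ψ : ℝ → Mat 𝕜 n} {a : ℝ}

/-- The lower bound over the time span from `0` to `t` makes `Ψ t` injective, hence invertible in
finite dimension. -/
theorem isUnit (hS : IsTimeScale S) (h0 : ∀ t ∈ S, 0 ≤ t) (h : IsTransition S A a Ψ) {t : ℝ}
    (ht : t ∈ S) : IsUnit (Ψ t) := by
  obtain ⟨c, hc, hle⟩ := h.exists_le_norm t
  have hinj : Function.Injective (Ψ t) := by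
    rw [injective_iff_map_eq_zero]
    intro v hv
    have := hle 0 hS.zero_mem t ht (h0 t ht) (by linarith) v
    rw [hv, norm_zero, h.eq_one 0 le_rfl, one_apply_eq_self] at this
    have h2 : ‖v‖ ≤ 0 := by
      by_contra! h3
      linarith [mul_pos hc h3]
    exact norm_le_zero_iff.1 h2
  have hker : LinearMap.ker (Ψ t : Vec 𝕜 n →ₗ[𝕜] Vec 𝕜 n) = ⊥ := LinearMap.ker_eq_bot.2 hinj
  have hu : IsUnit (Ψ t : Vec 𝕜 n →ₗ[𝕜] Vec 𝕜 n) :=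
    (LinearMap.isUnit_iff_ker_eq_bot _).2 hker
  exact ContinuousLinearMap.isUnit_iff_bijective.2 ((Module.End.isUnit_iff _).1 hu)

/-- The fundamental matrix `Φ(t, s)` given by `Ψ`. -/
theorem isFundamentalMatrix (hS : IsTimeScale S) (h0 : ∀ t ∈ S, 0 ≤ t)
    (h : IsTransition S A a Ψ) :
    IsFundamentalMatrix S A fun t s => Ψ t * Ring.inverse (Ψ s) := by
  intro s hs
  refine ⟨Ring.mul_inverse_cancel _ (h.isUnit hS h0 hs), fun t ht => ?_⟩
  have h1 := (h.hasDeltaDerivAt t ht.1).fwd ht.2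
  set M := Ring.inverse (Ψ s) with hM
  intro ε hε
  filter_upwards [h1 (ε / (‖M‖ + 1)) (by positivity)] with r hr
  have e1 : Ψ (sigma (fwd S s) t) * M - Ψ r * M - (sigma (fwd S s) t - r) • (A t * (Ψ t * M)) =
      (Ψ (sigma (fwd S s) t) - Ψ r - (sigma (fwd S s) t - r) • (A t * Ψ t)) * M := by
    rw [sub_mul, sub_mul, real_smul_mul, mul_assoc]
  rw [e1]
  calc _ ≤ (ε / (‖M‖ + 1) * |sigma (fwd S s) t - r|) * ‖M‖ :=
        (norm_mul_le _ _).trans (mul_le_mul_of_nonneg_right hr (norm_nonneg _))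
    _ = (ε * |sigma (fwd S s) t - r|) * (‖M‖ / (‖M‖ + 1)) := by ring
    _ ≤ (ε * |sigma (fwd S s) t - r|) * 1 := by
      gcongr
      rw [div_le_one (by positivity)]
      linarith
    _ = _ := mul_one _

theorem inverse_apply (hS : IsTimeScale S) (h0 : ∀ t ∈ S, 0 ≤ t) (h : IsTransition S A a Ψ)
    {t : ℝ} (ht : t ∈ S) (v : Vec 𝕜 n) : Ψ t (Ring.inverse (Ψ t) v) = v := by
  rw [← mul_apply_eq_comp, Ring.mul_inverse_cancel _ (h.isUnit hS h0 ht)]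
  rfl

end IsTransition

end transition

/-! ### Smooth paths that collect prescribed increments. -/

section ramp

open Real (smoothTransition)

variable {E : Type*} [NormedAddCommGroup E] [NormedSpace ℝ E]

theorem deriv_smoothTransition_of_nonpos {x : ℝ} (h : x ≤ 0) : deriv smoothTransition x = 0 := by
  refine IsLocalMin.deriv_eq_zero (Eventually.of_forall fun y => ?_)
  rw [smoothTransition.zero_of_nonpos h]
  exact smoothTransition.nonneg y

theorem deriv_smoothTransition_of_one_le {x : ℝ} (h : 1 ≤ x) : deriv smoothTransition x = 0 := by
  refine IsLocalMax.deriv_eq_zero (Eventually.of_forall fun y => ?_)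
  rw [smoothTransition.one_of_one_le h]
  exact smoothTransition.le_one y

theorem exists_deriv_smoothTransition_le : ∃ D : ℝ, 0 ≤ D ∧
    ∀ x, ‖deriv smoothTransition x‖ ≤ D := by
  have hc : Continuous (deriv smoothTransition) :=
    (smoothTransition.contDiff (n := 1)).continuous_deriv le_rfl
  obtain ⟨D, hD⟩ := (isCompact_Icc (a := (0 : ℝ)) (b := 1)).exists_bound_of_continuousOn
    hc.continuousOn
  have hD0 : 0 ≤ D := (norm_nonneg _).trans (hD 0 ⟨le_rfl, zero_le_one⟩)
  refine ⟨D, hD0, fun x => ?_⟩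
  rcases le_total x 0 with h | h
  · rwa [deriv_smoothTransition_of_nonpos h, norm_zero]
  · rcases le_total 1 x with h1 | h1
    · rwa [deriv_smoothTransition_of_one_le h1, norm_zero]
    · exact hD x ⟨h, h1⟩

/-- A smooth path that picks up `v i` during the time interval `[τ i, τ i + 1]`. -/
def ramp (τ : ℕ → ℝ) (v : ℕ → E) (t : ℝ) : E :=
  ∑ i ∈ Finset.range ⌈t⌉₊, smoothTransition (t - τ i) • v i

variable {τ : ℕ → ℝ} {v : ℕ → E} (hτ : ∀ i : ℕ, (i : ℝ) ≤ τ i)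
include hτ

/-- Terms that have not started vanish, so the cutoff `⌈t⌉₊` is immaterial: `i ≤ τ i` ensures that
everything beyond it has not started. A locally constant cutoff then gives smoothness. -/
theorem ramp_eq_sum {t : ℝ} {N : ℕ} (h : ∀ i, N ≤ i → t ≤ τ i) :
    ramp τ v t = ∑ i ∈ Finset.range N, smoothTransition (t - τ i) • v i := by
  have key : ∀ M : ℕ, (∀ i, M ≤ i → t ≤ τ i) →
      ∑ i ∈ Finset.range M, smoothTransition (t - τ i) • v i =
      ∑ i ∈ Finset.range (max M (max N ⌈t⌉₊)), smoothTransition (t - τ i) • v i := by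
    intro M hM
    refine Finset.sum_subset (Finset.range_mono (le_max_left _ _)) fun i _ hi => ?_
    rw [Finset.mem_range, not_lt] at hi
    rw [smoothTransition.zero_of_nonpos (by linarith [hM i hi]), zero_smul]
  have h1 := key N h
  have h2 := key ⌈t⌉₊ fun i hi => (Nat.ceil_le.1 hi).trans (hτ i)
  rw [ramp, h2, h1]
  congr 2
  simp

theorem ramp_eventuallyEq (t : ℝ) : ramp τ v =ᶠ[𝓝 t]
    fun s => ∑ i ∈ Finset.range ⌈t + 1⌉₊, smoothTransition (s - τ i) • v i := by
  filter_upwards [gt_mem_nhds (lt_add_one t)] with s hs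
  exact ramp_eq_sum hτ fun i hi => hs.le.trans ((Nat.ceil_le.1 hi).trans (hτ i))

theorem contDiff_ramp : ContDiff ℝ 1 (ramp τ v) := by
  refine contDiff_iff_contDiffAt.2 fun t => ContDiffAt.congr_of_eventuallyEq ?_
    (ramp_eventuallyEq hτ t)
  refine ContDiff.contDiffAt (ContDiff.sum fun i _ => ?_)
  exact ((smoothTransition.contDiff (n := 1)).comp (contDiff_id.sub contDiff_const)).smul
    contDiff_const

theorem ramp_of_nonpos {t : ℝ} (h : t ≤ 0) : ramp τ v t = 0 := by
  rw [ramp_eq_sum hτ (N := 0) fun i _ => h.trans ((Nat.cast_nonneg i).trans (hτ i)),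
    Finset.sum_range_zero]

theorem ramp_eq {t : ℝ} {i : ℕ} (h₁ : ∀ j < i, τ j + 1 ≤ t) (h₂ : ∀ j, i < j → t ≤ τ j) :
    ramp τ v t = ∑ j ∈ Finset.range i, v j + smoothTransition (t - τ i) • v i := by
  rw [ramp_eq_sum hτ (N := i + 1) fun j hj => h₂ j hj, Finset.sum_range_succ]
  congr 1
  refine Finset.sum_congr rfl fun j hj => ?_
  rw [smoothTransition.one_of_one_le (by linarith [h₁ j (Finset.mem_range.1 hj)]), one_smul]

theorem deriv_ramp {t : ℝ} {i : ℕ} (h₁ : ∀ j < i, τ j + 1 ≤ t) (h₂ : ∀ j, i < j → t ≤ τ j) :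
    deriv (ramp τ v) t = deriv smoothTransition (t - τ i) • v i := by
  rw [(ramp_eventuallyEq hτ t).deriv_eq]
  have hd : ∀ j, HasDerivAt (fun s => smoothTransition (s - τ j) • v j)
      (deriv smoothTransition (t - τ j) • v j) t := by
    intro j
    have h3 : HasDerivAt smoothTransition (deriv smoothTransition (t - τ j)) (t - τ j) :=
      ((smoothTransition.contDiff (n := 1)).differentiable (by norm_num) _).hasDerivAt
    exact (h3.comp_sub_const t (τ j)).smul_const (v j)
  rw [(HasDerivAt.fun_sum fun j _ => hd j).deriv]
  have hz : ∀ j, j ≠ i → deriv smoothTransition (t - τ j) • v j = 0 := by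
    intro j hj
    rcases lt_or_gt_of_ne hj with h | h
    · rw [deriv_smoothTransition_of_one_le (by linarith [h₁ j h]), zero_smul]
    · rw [deriv_smoothTransition_of_nonpos (by linarith [h₂ j h]), zero_smul]
  rw [Finset.sum_eq_single i (fun j _ hj => hz j hj)]
  intro hi
  rw [Finset.mem_range, not_lt] at hi
  rw [deriv_smoothTransition_of_nonpos, zero_smul]
  linarith [Nat.ceil_le.1 hi, hτ i]

end ramp

/-! ### Division of the time scale into blocks. -/

section blocks

variable {S : Set ℝ}

/-- Each block time is the least point of `S` at distance at least `L` from the previous one. A gap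
may make the block much longer than `L`, but then all its points other than the right end still lie
within `L` of its start. -/
theorem exists_blockTimes (hS : IsTimeScale S) (L : ℝ) : ∃ t : ℕ → ℝ, t 0 = 0 ∧ (∀ i, t i ∈ S) ∧
    (∀ i, t i + L ≤ t (i + 1)) ∧ ∀ i, ∀ s ∈ S, s < t (i + 1) → s < t i + L := by
  have hnext : ∀ p : ℝ, IsLeast (S ∩ Ici (p + L)) (sInf (S ∩ Ici (p + L))) := by
    intro p
    have hb : BddBelow (S ∩ Ici (p + L)) := ⟨p + L, fun _ hx => hx.2⟩
    obtain ⟨s, hs, hps⟩ := hS.exists_gt (p + L)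
    exact ⟨(hS.isClosed.inter isClosed_Ici).csInf_mem ⟨s, hs, hps.le⟩ hb,
      fun x hx => csInf_le hb hx⟩
  let t : ℕ → ℝ := fun i => Nat.rec 0 (fun _ p => sInf (S ∩ Ici (p + L))) i
  have hsucc : ∀ i, t (i + 1) = sInf (S ∩ Ici (t i + L)) := fun _ => rfl
  refine ⟨t, rfl, fun i => ?_, fun i => ?_, fun i s hs hlt => ?_⟩
  · cases i with
    | zero => exact hS.zero_mem
    | succ i => exact (hnext (t i)).1.1
  · exact (hnext (t i)).1.2
  · by_contra! h
    exact absurd ((hnext (t i)).2 ⟨hs, h⟩) (not_le.2 hlt)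

variable {t : ℕ → ℝ} {L : ℝ}

theorem mul_le_blockTimes (h0 : t 0 = 0) (hL : ∀ i, t i + L ≤ t (i + 1)) (i : ℕ) :
    i * L ≤ t i := by
  induction i with
  | zero => simp [h0]
  | succ i ih =>
    push_cast
    linarith [hL i]

theorem exists_mem_block (h0 : t 0 = 0) (hL : ∀ i, t i + 1 ≤ t (i + 1)) {r : ℝ}
    (hr : 0 ≤ r) : ∃ i, t i ≤ r ∧ r < t (i + 1) := by
  have hex : ∃ i, r < t (i + 1) := by
    obtain ⟨N, hN⟩ := exists_nat_gt r
    refine ⟨N, ?_⟩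
    have := mul_le_blockTimes h0 hL (N + 1)
    push_cast at this
    linarith
  classical
  refine ⟨Nat.find hex, ?_, Nat.find_spec hex⟩
  rcases h : Nat.find hex with _ | k
  · rwa [h0]
  · exact not_lt.1 (Nat.find_min hex (m := k) (by omega))

theorem blockTimes_add_one_le (hL : ∀ i, t i + 1 ≤ t (i + 1)) {i j : ℕ} (hij : i < j) :
    t i + 1 ≤ t j := by
  have hm : Monotone t := monotone_nat_of_le_succ fun k => by linarith [hL k]
  exact (hL i).trans (hm hij)

end blocks

/-! ### A small perturbation with a fast growing solution. -/

section perturbation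

open Real (smoothTransition)

variable {𝕜 : Type*} [RCLike 𝕜] {n : ℕ}

/-- Evaluation of operators at vectors, as an `ℝ`-bilinear map. -/
def applyBilin (𝕜 : Type*) [RCLike 𝕜] (n : ℕ) : Mat 𝕜 n →L[ℝ] Vec 𝕜 n →L[ℝ] Vec 𝕜 n :=
  LinearMap.mkContinuous₂
    (LinearMap.mk₂ ℝ (fun (M : Mat 𝕜 n) (v : Vec 𝕜 n) => M v) (fun _ _ _ => rfl)
      (fun _ _ _ => rfl) (fun M v w => map_add M v w) fun c M v => M.map_smul_of_tower c v)
    1 fun M v => by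
      rw [one_mul]
      exact M.le_opNorm v

/-- The product rule for an operator applied to a vector. -/
theorem HasDeltaDerivAt.clm_apply {S : Set ℝ} (hS : IsTimeScale S) {Ψ : ℝ → Mat 𝕜 n}
    {z : ℝ → Vec 𝕜 n} {M : Mat 𝕜 n} {w : Vec 𝕜 n} {t : ℝ} (ht : t ∈ S)
    (hΨ : HasDeltaDerivAt S Ψ M t) (hz : HasDeltaDerivAt S z w t) :
    HasDeltaDerivAt S (fun r => Ψ r (z r)) (M (z t) + Ψ (sigma S t) w) t := by
  rcases (hS.le_sigma t).eq_or_lt with h | h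
  · rw [hasDeltaDerivAt_iff_hasDerivWithinAt h.symm] at hΨ hz ⊢
    have := (applyBilin 𝕜 n).hasDerivWithinAt_of_bilinear hΨ hz
    rw [← h, add_comm]
    exact this
  · have hj := hS.hasDeltaDerivAt_jump ht hΨ
    rw [hasDeltaDerivAt_iff_of_lt ht h] at hΨ hz ⊢
    refine ⟨hΨ.1.clm_apply hz.1, ?_⟩
    rw [hz.2, map_add, (Ψ (sigma S t)).map_smul_of_tower, smul_add, ← add_assoc, hj]
    congr 1

/-- An additive change of `z`, small as seen by `P`, after which `Q` stretches `z` almost as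
much as `‖Q P⁻¹‖` allows. -/
theorem exists_kick {P Q : Mat 𝕜 n} (hP : IsUnit P) {η : ℝ} (hη : 0 ≤ η) (z : Vec 𝕜 n) :
    ∃ v, ‖P v‖ ≤ η * ‖P z‖ ∧
      η / 2 * ‖Q * Ring.inverse P‖ * ‖P z‖ ≤ ‖Q (z + v)‖ := by
  obtain ⟨w, hw1, hw2⟩ : ∃ w : Vec 𝕜 n, ‖w‖ ≤ 1 ∧
      1 / 2 * ‖Q * Ring.inverse P‖ ≤ ‖(Q * Ring.inverse P) w‖ := by
    rcases (norm_nonneg (Q * Ring.inverse P)).eq_or_lt with h | h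
    · exact ⟨0, by simp, by rw [← h]; simp⟩
    · obtain ⟨w, h1, h2⟩ := (Q * Ring.inverse P).exists_lt_apply_of_lt_opNorm
        (show 1 / 2 * ‖Q * Ring.inverse P‖ < ‖Q * Ring.inverse P‖ by linarith)
      exact ⟨w, h1.le, h2.le⟩
  set c : ℝ := η * ‖P z‖ with hc
  have hc0 : 0 ≤ c := by positivity
  set v : Vec 𝕜 n := c • Ring.inverse P w with hv
  have hPv : P v = c • w := by
    rw [hv, P.map_smul_of_tower, ← mul_apply_eq_comp, Ring.mul_inverse_cancel _ hP]
    rfl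
  have hQv : Q v = c • (Q * Ring.inverse P) w := by
    rw [hv, Q.map_smul_of_tower]
    rfl
  have hPn : ‖P v‖ ≤ c := by
    rw [hPv, norm_smul, Real.norm_of_nonneg hc0]
    exact mul_le_of_le_one_right hc0 hw1
  have hQn : η / 2 * ‖Q * Ring.inverse P‖ * ‖P z‖ ≤ ‖Q v‖ := by
    rw [hQv, norm_smul, Real.norm_of_nonneg hc0, hc]
    calc _ = η * ‖P z‖ * (1 / 2 * ‖Q * Ring.inverse P‖) := by ring
      _ ≤ _ := by gcongr
  -- Cancellation between `Q z` and `Q v` cannot occur for both signs of `v`, so one of the two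
  -- kicks achieves at least `‖Q v‖`.
  have hsum : 2 * ‖Q v‖ ≤ ‖Q (z + v)‖ + ‖Q (z + -v)‖ := by
    have h1 : (2 : ℝ) • Q v = Q (z + v) - Q (z + -v) := by
      rw [map_add, map_add, map_neg, two_smul]
      abel
    calc 2 * ‖Q v‖ = ‖(2 : ℝ) • Q v‖ := by rw [norm_smul]; norm_num
      _ ≤ _ := by
        rw [h1]
        exact norm_sub_le _ _
  rcases le_total ‖Q (z + -v)‖ ‖Q (z + v)‖ with h | h
  · exact ⟨v, hPn, by linarith⟩
  · exact ⟨-v, by rwa [map_neg, norm_neg], by linarith⟩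

/-- Each kick depends on the state left by the earlier ones, so the kicks and the partial sums are
built by a joint recursion. -/
theorem exists_kick_sequence {P : ℕ → Mat 𝕜 n} (hP : ∀ i, IsUnit (P i)) {η : ℝ} (hη : 0 ≤ η)
    (z₀ : Vec 𝕜 n) : ∃ v : ℕ → Vec 𝕜 n,
      (∀ i, ‖P i (v i)‖ ≤ η * ‖P i (z₀ + ∑ j ∈ Finset.range i, v j)‖) ∧
      ∀ i, η / 2 * ‖P (i + 1) * Ring.inverse (P i)‖ *
        ‖P i (z₀ + ∑ j ∈ Finset.range i, v j)‖ ≤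
          ‖P (i + 1) (z₀ + ∑ j ∈ Finset.range (i + 1), v j)‖ := by
  choose k hk1 hk2 using fun i z => exists_kick (Q := P (i + 1)) (hP i) hη z
  let Z : ℕ → Vec 𝕜 n := fun i => Nat.rec z₀ (fun i z => z + k i z) i
  have hZ : ∀ i, z₀ + ∑ j ∈ Finset.range i, k j (Z j) = Z i := by
    intro i
    induction i with
    | zero => simp [Z]
    | succ i ih => rw [Finset.sum_range_succ, ← add_assoc, ih]
  refine ⟨fun i => k i (Z i), fun i => ?_, fun i => ?_⟩
  · rw [hZ]
    exact hk1 i (Z i)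
  · rw [hZ, hZ]
    exact hk2 i (Z i)

theorem isUnit_one_add_of_norm_lt_one {X : Mat 𝕜 n} (h : ‖X‖ < 1) : IsUnit (1 + X) := by
  have := isUnit_one_sub_of_norm_lt_one (x := -X) (by rwa [norm_neg])
  rwa [sub_neg_eq_add] at this

/-- The rank one operator that maps `x` to `w`. -/
def rankOneTo (w x : Vec 𝕜 n) : Mat 𝕜 n := (‖x‖ ^ 2)⁻¹ • InnerProductSpace.rankOne 𝕜 w x

theorem rankOneTo_apply {w x : Vec 𝕜 n} (hx : x ≠ 0) : rankOneTo w x x = w := by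
  have h : ‖x‖ ≠ 0 := norm_ne_zero_iff.2 hx
  have h1 : rankOneTo w x x = (‖x‖ ^ 2)⁻¹ • (inner 𝕜 x x • w) := rfl
  rw [h1, inner_self_eq_norm_sq_to_K]
  have h2 : ((‖x‖ : 𝕜) ^ 2) • w = (‖x‖ ^ 2 : ℝ) • w := by
    rw [← RCLike.ofReal_pow, RCLike.real_smul_eq_coe_smul (K := 𝕜)]
  rw [h2, inv_smul_smul₀ (pow_ne_zero 2 h)]

theorem norm_rankOneTo (w x : Vec 𝕜 n) : ‖rankOneTo w x‖ = ‖w‖ / ‖x‖ := by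
  rw [rankOneTo, norm_smul, InnerProductSpace.norm_rankOne, norm_inv, norm_pow, norm_norm]
  rcases eq_or_ne ‖x‖ 0 with h | h
  · simp [h]
  · field_simp

/-- The rank one operator depends continuously on its two vectors. The normalizing factor is moved
onto `x`, where `x ≠ 0` keeps it continuous; being real, it passes through the conjugate-linear slot
unchanged. -/
theorem rdContinuous_rankOneTo {T : Set ℝ} {w x : ℝ → Vec 𝕜 n} (hw : RdContinuous T w)
    (hx : Continuous x) (hx0 : ∀ t ∈ T, x t ≠ 0) :
    RdContinuous T fun t => rankOneTo (w t) (x t) := by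
  have h1 : RdContinuous T fun t => (‖x t‖ ^ 2)⁻¹ • x t := by
    have h4 : ContinuousOn (fun t => (‖x t‖ ^ 2)⁻¹) T := (hx.norm.pow 2).continuousOn.inv₀
      fun t ht => pow_ne_zero 2 (norm_ne_zero_iff.2 (hx0 t ht))
    exact rdContinuous_of_continuousOn (h4.smul hx.continuousOn)
  have h2 : Continuous fun p : Vec 𝕜 n × Vec 𝕜 n =>
      (InnerProductSpace.rankOne 𝕜 p.1 p.2 : Mat 𝕜 n) := by
    have h4 := (ContinuousLinearMap.smulRightL 𝕜 (Vec 𝕜 n) (Vec 𝕜 n)).continuous₂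
    exact h4.comp (((innerSL 𝕜).continuous.comp continuous_snd).prodMk continuous_fst)
  have h3 := hw.comp₂ (φ := fun p q => (InnerProductSpace.rankOne 𝕜 p q : Mat 𝕜 n)) h2 h1
  refine (funext fun t => ?_ : (fun t => rankOneTo (w t) (x t)) = _) ▸ h3
  rw [rankOneTo, RCLike.real_smul_eq_coe_smul (K := 𝕜) (E := Mat 𝕜 n),
    RCLike.real_smul_eq_coe_smul (K := 𝕜) (E := Vec 𝕜 n), map_smulₛₗ, RCLike.conj_ofReal]

theorem deltaQuot_const_add {E : Type*} [NormedAddCommGroup E] [NormedSpace ℝ E] (T : Set ℝ)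
    (c : E) (z : ℝ → E) (t : ℝ) : deltaQuot T (fun r => c + z r) t = deltaQuot T z t := by
  simp [deltaQuot]

/-- In the block that starts at `τ i`, the `Δ`-derivative of `ramp τ v` is a bounded multiple
of `v i`, and it vanishes one unit of time after the start. -/
theorem exists_deltaQuot_ramp_eq {T : Set ℝ} (hT : IsTimeScale T) {E : Type*}
    [NormedAddCommGroup E] [NormedSpace ℝ E] {τ : ℕ → ℝ} (v : ℕ → E) {D : ℝ}
    (hD : ∀ x, ‖deriv smoothTransition x‖ ≤ D) (hτ : ∀ i : ℕ, (i : ℝ) ≤ τ i)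
    (hτT : ∀ i, τ i ∈ T) (hτ1 : ∀ i, τ i + 1 ≤ τ (i + 1)) {t : ℝ} {i : ℕ} (hi : τ i ≤ t)
    (hi' : t < τ (i + 1)) :
    ∃ q : ℝ, deltaQuot T (ramp τ v) t = q • v i ∧ |q| ≤ D ∧ |mu T t * q| ≤ 1 ∧
      (τ i + 1 ≤ t → q = 0) := by
  have hσ : sigma T t ≤ τ (i + 1) := sigma_le (hτT _) hi'
  have hle := hT.le_sigma t
  have hm : Monotone τ := monotone_nat_of_le_succ fun k => by linarith [hτ1 k]
  have hA : ∀ s, t ≤ s → (∀ j < i, τ j + 1 ≤ s) := fun s hs j hj =>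
    (blockTimes_add_one_le hτ1 hj).trans (hi.trans hs)
  have hB : ∀ s, s ≤ τ (i + 1) → (∀ j, i < j → s ≤ τ j) := fun s hs j hj =>
    hs.trans (hm hj)
  have e1 := ramp_eq (v := v) hτ (hA t le_rfl) (hB t hi'.le)
  have e2 := ramp_eq (v := v) hτ (hA _ hle) (hB _ hσ)
  have e3 := deriv_ramp (v := v) hτ (hA t le_rfl) (hB t hi'.le)
  by_cases h : mu T t = 0
  · refine ⟨deriv smoothTransition (t - τ i), ?_, hD _, by rw [h]; simp, fun h1 => ?_⟩
    · rw [deltaQuot, if_pos h, e3]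
    · exact deriv_smoothTransition_of_one_le (by linarith)
  · have hμ : 0 < mu T t := lt_of_le_of_ne (hT.mu_nonneg t) (Ne.symm h)
    -- Only the summand of the current block changes between `t` and `σ(t)`. The mean value
    -- inequality bounds its quotient by `D`, and values in `[0, 1]` bound its increment `μ q` by
    -- `1`, however long the gap.
    refine ⟨(mu T t)⁻¹ * (smoothTransition (sigma T t - τ i) - smoothTransition (t - τ i)),
      ?_, ?_, ?_, fun h1 => ?_⟩
    · rw [deltaQuot, if_neg h, e1, e2, mul_smul, sub_smul]
      congr 1
      abel
    · have h2 := (convex_univ (𝕜 := ℝ) (E := ℝ)).norm_image_sub_le_of_norm_deriv_le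
        (f := smoothTransition) (C := D) (x := t - τ i) (y := sigma T t - τ i)
        (fun x _ => (smoothTransition.contDiff (n := 1)).differentiable (by norm_num) x)
        (fun x _ => hD x) (mem_univ _) (mem_univ _)
      have h3 : sigma T t - τ i - (t - τ i) = mu T t := by rw [mu]; ring
      rw [h3, Real.norm_eq_abs, Real.norm_of_nonneg hμ.le] at h2
      rw [abs_mul, abs_of_pos (inv_pos.2 hμ), inv_mul_le_iff₀ hμ, mul_comm]
      exact h2
    · rw [mul_inv_cancel_left₀ h, abs_le]
      have b1 := smoothTransition.nonneg (sigma T t - τ i)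
      have b2 := smoothTransition.le_one (sigma T t - τ i)
      have b3 := smoothTransition.nonneg (t - τ i)
      have b4 := smoothTransition.le_one (t - τ i)
      constructor <;> linarith
    · rw [smoothTransition.one_of_one_le (by linarith),
        smoothTransition.one_of_one_le (by linarith), sub_self, mul_zero]

theorem deltaQuot_ramp_of_neg {T : Set ℝ} (hT : IsTimeScale T) {E : Type*}
    [NormedAddCommGroup E] [NormedSpace ℝ E] {τ : ℕ → ℝ} (v : ℕ → E)
    (hτ : ∀ i : ℕ, (i : ℝ) ≤ τ i) {t : ℝ} (ht : t < 0) : deltaQuot T (ramp τ v) t = 0 := by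
  have h1 : sigma T t ≤ 0 := sigma_le hT.zero_mem ht
  unfold deltaQuot
  split_ifs with h
  · have : ramp τ v =ᶠ[𝓝 t] fun _ => 0 := by
      filter_upwards [gt_mem_nhds ht] with s hs
      exact ramp_of_nonpos hτ hs.le
    rw [this.deriv_eq, deriv_const]
  · rw [ramp_of_nonpos hτ h1, ramp_of_nonpos hτ ht.le, sub_self, smul_zero]

/-- A path `z` whose image `x = Ψ z` grows over each block almost as fast as the norm of the
transition matrix, while `Ψ z^Δ` is small compared to `x`. -/
theorem exists_path [Nontrivial (Vec 𝕜 n)] {T : Set ℝ} (hT : IsTimeScale T)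
    {A Ψ : ℝ → Mat 𝕜 n} {a : ℝ} (ha : 0 ≤ a) (hΨ : IsTransition (fwd T 0) A a Ψ) {D κ : ℝ}
    (hD0 : 0 ≤ D) (hD : ∀ x, ‖deriv smoothTransition x‖ ≤ D) (hκpos : 0 < κ) :
    ∃ η > 0, ∀ τ : ℕ → ℝ, τ 0 = 0 → (∀ i, τ i ∈ fwd T 0) → (∀ i, τ i + 1 ≤ τ (i + 1)) →
      ∃ z : ℝ → Vec 𝕜 n, ContDiff ℝ 1 z ∧ (∀ t ∈ T, Ψ t (z t) ≠ 0) ∧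
        (∀ t ∈ T, ∃ q : ℝ, |q| ≤ D ∧ |mu T t * q| ≤ 1 ∧
          ‖Ψ t (deltaQuot T z t)‖ ≤ |q| * κ * ‖Ψ t (z t)‖) ∧
        ∀ i, η * ‖Ψ (τ (i + 1)) * Ring.inverse (Ψ (τ i))‖ * ‖Ψ (τ i) (z (τ i))‖ ≤
          ‖Ψ (τ (i + 1)) (z (τ (i + 1)))‖ := by
  have hS := hT.fwd_zero
  have h0 : ∀ t ∈ fwd T 0, 0 ≤ t := fun t ht => ht.2
  obtain ⟨c, hc, hcle⟩ := hΨ.exists_le_norm 1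
  -- The bound `1 / 2` keeps the kicked state at least half its size. The second bound makes `‖Ψ t
  -- (v i)‖ ≤ κ ‖Ψ t (z t)‖` during the first unit of the block, where `Ψ` expands by at most `exp
  -- a` and contracts by no more than the factor `c`. Neither involves `τ`.
  set η : ℝ := min (1 / 2) (κ * c / (2 * Real.exp a)) with hη
  have hηpos : 0 < η := by positivity
  have hη2 : η ≤ 1 / 2 := min_le_left _ _
  have hηκ : Real.exp a * η ≤ κ * (c / 2) := by
    have h1 : η ≤ κ * c / (2 * Real.exp a) := min_le_right _ _
    rw [le_div_iff₀ (by positivity)] at h1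
    linarith
  refine ⟨η / 2, by positivity, fun τ hτ0 hτT hτ1 => ?_⟩
  have hτ : ∀ i : ℕ, (i : ℝ) ≤ τ i := fun i => by
    have := mul_le_blockTimes hτ0 hτ1 i
    rwa [mul_one] at this
  have hunit : ∀ t ∈ fwd T 0, IsUnit (Ψ t) := fun t ht => hΨ.isUnit hS h0 ht
  have hne : ∀ t ∈ fwd T 0, ∀ w : Vec 𝕜 n, w ≠ 0 → Ψ t w ≠ 0 := fun t ht w hw h =>
    hw ((ContinuousLinearMap.isUnit_iff_bijective.1 (hunit t ht)).1 (h.trans (map_zero _).symm))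
  obtain ⟨z₀, hz₀⟩ := exists_ne (0 : Vec 𝕜 n)
  obtain ⟨v, hv1, hv2⟩ := exists_kick_sequence (P := fun i => Ψ (τ i))
    (fun i => hunit _ (hτT i)) hηpos.le z₀
  set Z : ℕ → Vec 𝕜 n := fun i => z₀ + ∑ j ∈ Finset.range i, v j with hZ
  set z : ℝ → Vec 𝕜 n := fun t => z₀ + ramp τ v t with hz
  have hzC : ContDiff ℝ 1 z := contDiff_const.add (contDiff_ramp hτ)
  have hm : Monotone τ := monotone_nat_of_le_succ fun k => by linarith [hτ1 k]
  have hzblock : ∀ i t, τ i ≤ t → t ≤ τ (i + 1) →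
      z t = Z i + smoothTransition (t - τ i) • v i := by
    intro i t h1 h2
    simp only [hz, hZ]
    rw [ramp_eq hτ (fun j hj => (blockTimes_add_one_le hτ1 hj).trans h1)
      (fun j hj => h2.trans (hm hj)), add_assoc]
  have hlow : ∀ i (s : ℝ), 0 ≤ s → s ≤ 1 → ‖Ψ (τ i) (Z i)‖ ≤ 2 * ‖Ψ (τ i) (Z i + s • v i)‖ := by
    intro i s hs0 hs1
    have h1 : ‖s • Ψ (τ i) (v i)‖ ≤ 1 / 2 * ‖Ψ (τ i) (Z i)‖ := by
      rw [norm_smul, Real.norm_of_nonneg hs0]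
      calc s * ‖Ψ (τ i) (v i)‖ ≤ 1 * ‖Ψ (τ i) (v i)‖ := by gcongr
        _ ≤ η * ‖Ψ (τ i) (Z i)‖ := by
          rw [one_mul]
          exact hv1 i
        _ ≤ _ := by gcongr
    rw [map_add _ (Z i), (Ψ (τ i)).map_smul_of_tower]
    have h2 := norm_sub_le (Ψ (τ i) (Z i) + s • Ψ (τ i) (v i)) (s • Ψ (τ i) (v i))
    rw [add_sub_cancel_right] at h2
    linarith
  have hZne : ∀ i, Z i ≠ 0 := by
    intro i
    induction i with
    | zero => simpa [hZ] using hz₀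
    | succ i ih =>
      have h1 : Z (i + 1) = Z i + (1 : ℝ) • v i := by
        simp only [hZ]
        rw [Finset.sum_range_succ, one_smul, add_assoc]
      intro h2
      have h3 := hlow i 1 zero_le_one le_rfl
      rw [← h1, h2, map_zero, norm_zero, mul_zero] at h3
      exact hne _ (hτT i) _ ih (norm_le_zero_iff.1 h3)
  have hxne : ∀ t ∈ T, Ψ t (z t) ≠ 0 := by
    intro t ht
    rcases lt_or_ge t 0 with h | h
    · simp only [hz]
      rw [ramp_of_nonpos hτ h.le, hΨ.eq_one t h.le, add_zero]
      exact hz₀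
    · obtain ⟨i, hi1, hi2⟩ := exists_mem_block hτ0 hτ1 h
      refine hne t ⟨ht, h⟩ _ fun h1 => ?_
      rw [hzblock i t hi1 hi2.le] at h1
      have h3 := hlow i _ (smoothTransition.nonneg (t - τ i)) (smoothTransition.le_one _)
      rw [h1, map_zero, norm_zero, mul_zero] at h3
      exact hne _ (hτT i) _ (hZne i) (norm_le_zero_iff.1 h3)
  have hxτ : ∀ i, Ψ (τ i) (z (τ i)) = Ψ (τ i) (Z i) := by
    intro i
    rw [hzblock i (τ i) le_rfl (hm (Nat.le_succ i)), sub_self, smoothTransition.zero, zero_smul,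
      add_zero]
  refine ⟨z, hzC, hxne, fun t ht => ?_, fun i => ?_⟩
  · have hWt : deltaQuot T z t = deltaQuot T (ramp τ v) t := deltaQuot_const_add T z₀ _ t
    rcases lt_or_ge t 0 with h | h
    · refine ⟨0, by simpa using hD0, by simp, ?_⟩
      rw [hWt, deltaQuot_ramp_of_neg hT v hτ h]
      simp
    · obtain ⟨i, hi1, hi2⟩ := exists_mem_block hτ0 hτ1 h
      obtain ⟨q, hq1, hq2, hq3, hq4⟩ := exists_deltaQuot_ramp_eq hT v hD hτ
        (fun i => (hτT i).1) hτ1 hi1 hi2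
      refine ⟨q, hq2, hq3, ?_⟩
      rw [hWt, hq1, (Ψ t).map_smul_of_tower, norm_smul, Real.norm_eq_abs, mul_assoc]
      rcases le_or_gt (τ i + 1) t with h1 | h1
      · rw [hq4 h1]
        simp
      · refine mul_le_mul_of_nonneg_left ?_ (abs_nonneg q)
        have hti : t - τ i ≤ 1 := by linarith
        have b1 := hΨ.norm_le (τ i) (hτT i) t ⟨ht, h⟩ hi1 (v i)
        have b2 : Real.exp (a * (t - τ i)) ≤ Real.exp a :=
          Real.exp_le_exp.2 (mul_le_of_le_one_right ha hti)
        have b3 := hcle (τ i) (hτT i) t ⟨ht, h⟩ hi1 hti (z t)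
        have b4 := hlow i _ (smoothTransition.nonneg (t - τ i)) (smoothTransition.le_one _)
        rw [← hzblock i t hi1 hi2.le] at b4
        have b5 : c / 2 * ‖Ψ (τ i) (Z i)‖ ≤ ‖Ψ t (z t)‖ := by
          refine le_trans ?_ b3
          nlinarith
        calc ‖Ψ t (v i)‖ ≤ Real.exp a * (η * ‖Ψ (τ i) (Z i)‖) :=
              b1.trans (mul_le_mul b2 (hv1 i) (norm_nonneg _) (Real.exp_pos a).le)
          _ = (Real.exp a * η) * ‖Ψ (τ i) (Z i)‖ := by ring
          _ ≤ (κ * (c / 2)) * ‖Ψ (τ i) (Z i)‖ := by gcongr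
          _ = κ * (c / 2 * ‖Ψ (τ i) (Z i)‖) := by ring
          _ ≤ κ * ‖Ψ t (z t)‖ := by gcongr
  · rw [hxτ, hxτ]
    exact hv2 i

/-- The perturbation of `A` for which `Ψ z` is a solution. -/
theorem exists_perturbation_of_path {T : Set ℝ} (hT : IsTimeScale T)
    {A Ψ : ℝ → Mat 𝕜 n} {a : ℝ} (ha : 0 ≤ a) (hA : RdContinuous T A) (hAa : ∀ t ∈ T, ‖A t‖ ≤ a)
    (hreg : Regressive T A) (hΨ : IsTransition (fwd T 0) A a Ψ) {D κ : ℝ}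
    (hκpos : 0 < κ) (hκ : κ ≤ 1 / 2) {z : ℝ → Vec 𝕜 n} (hzC : ContDiff ℝ 1 z)
    (hxne : ∀ t ∈ T, Ψ t (z t) ≠ 0)
    (hWq : ∀ t ∈ T, ∃ q : ℝ, |q| ≤ D ∧ |mu T t * q| ≤ 1 ∧
      ‖Ψ t (deltaQuot T z t)‖ ≤ |q| * κ * ‖Ψ t (z t)‖) :
    ∃ B : ℝ → Mat 𝕜 n, RdContinuous T B ∧ (∀ t ∈ T, ‖B t‖ ≤ (D + a) * κ) ∧
      Regressive T (fun t => A t + B t) ∧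
      IsSolution T (fun t => A t + B t) 0 fun t => Ψ t (z t) := by
  have hS := hT.fwd_zero
  set x : ℝ → Vec 𝕜 n := fun t => Ψ t (z t) with hx
  have hxc : Continuous x := hΨ.continuous.clm_apply hzC.continuous
  set W : ℝ → Vec 𝕜 n := fun t => Ψ t (deltaQuot T z t) with hW
  set R : ℝ → Mat 𝕜 n := fun t => rankOneTo (W t) (x t) with hR
  have hRq : ∀ t ∈ T, ∃ q : ℝ, |q| ≤ D ∧ |mu T t * q| ≤ 1 ∧ ‖R t‖ ≤ |q| * κ := by
    intro t ht
    obtain ⟨q, h1, h2, h3⟩ := hWq t ht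
    refine ⟨q, h1, h2, ?_⟩
    simp only [hR]
    rw [norm_rankOneTo]
    exact div_le_of_le_mul₀ (norm_nonneg _) (by positivity) h3
  -- The factor `1 + μ A` is forced by the product rule, in which `Ψ` is evaluated at `σ(t)`.
  refine ⟨fun t => (1 + mu T t • A t) * R t, ?_, fun t ht => ?_, fun t ht => ?_, ?_⟩
  · have hWrd : RdContinuous T W :=
      (rdContinuous_of_continuousOn hΨ.continuous.continuousOn).comp₂
        (φ := fun (M : Mat 𝕜 n) (w : Vec 𝕜 n) => M w)
        (continuous_fst.clm_apply continuous_snd) (hT.rdContinuous_deltaQuot hzC)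
    have hRrd : RdContinuous T R := rdContinuous_rankOneTo hWrd hxc hxne
    have hM : RdContinuous T fun t => 1 + mu T t • A t :=
      hT.rdContinuous_mu.comp₂ (φ := fun (m : ℝ) (M : Mat 𝕜 n) => 1 + m • M)
        (continuous_const.add (continuous_fst.smul continuous_snd)) hA
    exact hM.comp₂ (φ := fun M N : Mat 𝕜 n => M * N) continuous_mul hRrd
  · obtain ⟨q, h1, h2, h3⟩ := hRq t ht
    have hμ := hT.mu_nonneg t
    have h4 : ‖1 + mu T t • A t‖ ≤ 1 + mu T t * a := by
      refine (norm_add_le _ _).trans (add_le_add ContinuousLinearMap.norm_id_le ?_)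
      rw [norm_smul, Real.norm_of_nonneg hμ]
      exact mul_le_mul_of_nonneg_left (hAa t ht) hμ
    rw [abs_mul, abs_of_nonneg hμ] at h2
    -- The unbounded factor `μ` is absorbed by `μ |q| ≤ 1`.
    calc ‖(1 + mu T t • A t) * R t‖ ≤ (1 + mu T t * a) * (|q| * κ) :=
          (norm_mul_le _ _).trans (mul_le_mul h4 h3 (norm_nonneg _) (by positivity))
      _ = (|q| + mu T t * |q| * a) * κ := by ring
      _ ≤ (D + 1 * a) * κ := by gcongr
      _ = (D + a) * κ := by rw [one_mul]
  · obtain ⟨q, h1, h2, h3⟩ := hRq t ht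
    have hμ := hT.mu_nonneg t
    have hfac : 1 + mu T t • (A t + (1 + mu T t • A t) * R t) =
        (1 + mu T t • A t) * (1 + mu T t • R t) := by
      have : (1 + mu T t • A t) * (mu T t • R t) = mu T t • ((1 + mu T t • A t) * R t) :=
        ContinuousLinearMap.ext fun w => by
          change (1 + mu T t • A t) (mu T t • R t w) = mu T t • (1 + mu T t • A t) (R t w)
          exact (1 + mu T t • A t).map_smul_of_tower _ _
      rw [mul_add, mul_one, this, smul_add, add_assoc]
    have hsmall : ‖mu T t • R t‖ < 1 := by
      rw [abs_mul, abs_of_nonneg hμ] at h2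
      rw [norm_smul, Real.norm_of_nonneg hμ]
      calc mu T t * ‖R t‖ ≤ mu T t * (|q| * κ) := by gcongr
        _ = (mu T t * |q|) * κ := by ring
        _ ≤ 1 * (1 / 2) := mul_le_mul h2 hκ hκpos.le zero_le_one
        _ < 1 := by norm_num
    rw [hfac]
    exact (hreg t ht).mul (isUnit_one_add_of_norm_lt_one hsmall)
  · intro t ht
    have h1 := hS.hasDeltaDerivAt_deltaQuot ht (hzC.differentiable (by norm_num) t)
    have h2 := HasDeltaDerivAt.clm_apply hS ht (hΨ.hasDeltaDerivAt t ht) h1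
    have h3 : (A t + (1 + mu T t • A t) * R t) (x t) =
        (A t * Ψ t) (z t) + Ψ (sigma (fwd T 0) t) (deltaQuot (fwd T 0) z t) := by
      have h4 : ((1 + mu T t • A t) * R t) (x t) = (1 + mu T t • A t) (W t) := by
        rw [mul_apply_eq_comp]
        congr 1
        exact rankOneTo_apply (hxne t ht.1)
      rw [add_apply, h4, hS.hasDeltaDerivAt_jump ht (hΨ.hasDeltaDerivAt t ht),
        mu_fwd ht.2, deltaQuot_fwd ht.2]
      rfl
    rw [h3]
    exact h2

/-- For a small perturbation of `A` some solution grows over each block almost as fast as the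
norm of the transition matrix. -/
theorem exists_perturbation [Nontrivial (Vec 𝕜 n)] {T : Set ℝ} (hT : IsTimeScale T)
    {A Ψ : ℝ → Mat 𝕜 n} {a : ℝ} (ha : 0 ≤ a) (hA : RdContinuous T A) (hAa : ∀ t ∈ T, ‖A t‖ ≤ a)
    (hreg : Regressive T A) (hΨ : IsTransition (fwd T 0) A a Ψ) {δ : ℝ} (hδ : 0 < δ) :
    ∃ η > 0, ∀ τ : ℕ → ℝ, τ 0 = 0 → (∀ i, τ i ∈ fwd T 0) → (∀ i, τ i + 1 ≤ τ (i + 1)) →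
      ∃ B : ℝ → Mat 𝕜 n, RdContinuous T B ∧ (∀ t ∈ T, ‖B t‖ ≤ δ) ∧
        Regressive T (fun t => A t + B t) ∧
        ∃ x : ℝ → Vec 𝕜 n, IsSolution T (fun t => A t + B t) 0 x ∧ x 0 ≠ 0 ∧
          ∀ i, η * ‖Ψ (τ (i + 1)) * Ring.inverse (Ψ (τ i))‖ * ‖x (τ i)‖ ≤ ‖x (τ (i + 1))‖ := by
  obtain ⟨D, hD0, hD⟩ := exists_deriv_smoothTransition_le
  set κ : ℝ := min (1 / 2) (δ / (D + a + 1)) with hκ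
  have hκpos : 0 < κ := by positivity
  obtain ⟨η, hη, H⟩ := exists_path hT ha hΨ hD0 hD hκpos
  refine ⟨η, hη, fun τ hτ0 hτT hτ1 => ?_⟩
  obtain ⟨z, hzC, hxne, hWq, hgrow⟩ := H τ hτ0 hτT hτ1
  obtain ⟨B, hB1, hB2, hB3, hB4⟩ := exists_perturbation_of_path hT ha hA hAa hreg hΨ hκpos
    (min_le_left _ _) hzC hxne hWq
  refine ⟨B, hB1, fun t ht => (hB2 t ht).trans ?_, hB3, _, hB4, hxne 0 hT.zero_mem, hgrow⟩
  calc (D + a) * κ ≤ (D + a + 1) * (δ / (D + a + 1)) :=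
        mul_le_mul (by linarith) (min_le_right _ _) hκpos.le (by positivity)
    _ = δ := by field_simp

end perturbation

/-! ### Upper functions from block norms, and the instability criterion. -/

section upper

open Real (smoothTransition)

/-- The function `u` with `e_u(t, s) = exp (g t - g s)`. -/
def expRate (S : Set ℝ) (g : ℝ → ℝ) (t : ℝ) : ℝ :=
  deltaQuot S (fun r => Real.exp (g r)) t * Real.exp (-g t)

variable {S : Set ℝ}

theorem one_add_mu_mul_expRate (g : ℝ → ℝ) (t : ℝ) :
    1 + mu S t * expRate S g t = Real.exp (g (sigma S t) - g t) := by
  have h := mu_smul_deltaQuot (T := S) (fun r => Real.exp (g r)) t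
  rw [smul_eq_mul] at h
  rw [expRate, ← mul_assoc, h, sub_mul, ← Real.exp_add, ← Real.exp_add, add_neg_cancel,
    Real.exp_zero, ← sub_eq_add_neg]
  ring

/-- The cylinder transformation takes the logarithm that `expRate` exponentiated, so `g` itself is
an antiderivative of the integrand in the definition of `e_u`. -/
theorem cylinder_expRate {g : ℝ → ℝ} (hg : Differentiable ℝ g) (t : ℝ) :
    cylinder (mu S t) (expRate S g t) = deltaQuot S g t := by
  unfold cylinder
  split_ifs with h
  · rw [expRate, deltaQuot, deltaQuot, if_pos h, if_pos h, (hg t).hasDerivAt.exp.deriv,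
      mul_comm, ← mul_assoc, ← Real.exp_add, neg_add_cancel, Real.exp_zero, one_mul]
  · rw [mul_comm, one_add_mu_mul_expRate, Real.log_exp, deltaQuot, if_neg h, smul_eq_mul]
    ring

theorem IsTimeScale.rdContinuous_expRate (hS : IsTimeScale S) {g : ℝ → ℝ}
    (hg : ContDiff ℝ 1 g) : RdContinuous S (expRate S g) :=
  (hS.rdContinuous_deltaQuot hg.exp).comp₂ (φ := fun x y : ℝ => x * y) continuous_mul
    (rdContinuous_of_continuousOn (Real.continuous_exp.comp hg.continuous.neg).continuousOn)

theorem positivelyRegressive_expRate (g : ℝ → ℝ) : PositivelyRegressive S (expRate S g) := by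
  intro t _
  rw [one_add_mu_mul_expRate]
  exact Real.exp_pos _

theorem deltaIntegral_cylinder_expRate (hS : IsTimeScale S) (h0 : ∀ t ∈ S, 0 ≤ t) {g : ℝ → ℝ}
    (hg : ContDiff ℝ 1 g) {s t : ℝ} (hs : s ∈ S) (ht : t ∈ S) :
    deltaIntegral S (fun r => cylinder (mu S r) (expRate S g r)) s t = g t - g s := by
  have hd : Differentiable ℝ g := hg.differentiable (by norm_num)
  refine deltaIntegral_eq hS h0 (fun r hr => ?_) hs ht
  rw [cylinder_expRate hd]
  exact hS.hasDeltaDerivAt_deltaQuot hr (hd r)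

variable {𝕜 : Type*} [RCLike 𝕜] {n : ℕ} {A Ψ : ℝ → Mat 𝕜 n} {a : ℝ}

theorem IsTransition.isUpperFunction_expRate (hS : IsTimeScale S) (h0 : ∀ t ∈ S, 0 ≤ t)
    (hΨ : IsTransition S A a Ψ) {g : ℝ → ℝ} (hg : ContDiff ℝ 1 g) {C : ℝ} (hC : 0 < C)
    (hle : ∀ s ∈ S, ∀ t ∈ S, s ≤ t →
      ‖Ψ t * Ring.inverse (Ψ s)‖ ≤ C * Real.exp (g t - g s)) :
    IsUpperFunction S A (expRate S g) := by
  refine ⟨hS.rdContinuous_expRate hg, positivelyRegressive_expRate g, _,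
    hΨ.isFundamentalMatrix hS h0, C, hC, fun s hs t ht hst => ?_⟩
  rw [genExp, deltaIntegral_cylinder_expRate hS h0 hg hs ht]
  exact hle s hs t ht hst

theorem IsTransition.norm_mul_inverse_le (hS : IsTimeScale S) (h0 : ∀ t ∈ S, 0 ≤ t)
    (hΨ : IsTransition S A a Ψ) {s t : ℝ} (hs : s ∈ S) (ht : t ∈ S) (hst : s ≤ t) :
    ‖Ψ t * Ring.inverse (Ψ s)‖ ≤ Real.exp (a * (t - s)) := by
  refine ContinuousLinearMap.opNorm_le_bound _ (Real.exp_pos _).le fun w => ?_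
  have := hΨ.norm_le s hs t ht hst (Ring.inverse (Ψ s) w)
  rwa [hΨ.inverse_apply hS h0 hs] at this

theorem IsTransition.exists_norm_inverse_le (hS : IsTimeScale S) (h0 : ∀ t ∈ S, 0 ≤ t)
    (hΨ : IsTransition S A a Ψ) (D : ℝ) : ∃ C > 0, ∀ s ∈ S, ∀ t ∈ S, s ≤ t → t - s ≤ D →
      ‖Ψ s * Ring.inverse (Ψ t)‖ ≤ C := by
  obtain ⟨c, hc, hle⟩ := hΨ.exists_le_norm D
  refine ⟨c⁻¹, inv_pos.2 hc, fun s hs t ht hst hD => ?_⟩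
  refine ContinuousLinearMap.opNorm_le_bound _ (inv_pos.2 hc).le fun w => ?_
  have := hle s hs t ht hst hD (Ring.inverse (Ψ t) w)
  rw [hΨ.inverse_apply hS h0 ht] at this
  rw [mul_apply_eq_comp]
  rwa [le_inv_mul_iff₀ hc]

theorem IsTransition.mul_inverse_mul (hS : IsTimeScale S) (h0 : ∀ t ∈ S, 0 ≤ t)
    (hΨ : IsTransition S A a Ψ) {s : ℝ} (hs : s ∈ S) (M N : Mat 𝕜 n) :
    (M * Ring.inverse (Ψ s)) * (Ψ s * N) = M * N := by
  rw [mul_assoc, ← mul_assoc (Ring.inverse _), Ring.inverse_mul_cancel _ (hΨ.isUnit hS h0 hs),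
    one_mul]

/-- The norms of the transition matrices over the blocks give rise to an upper function. -/
theorem IsTransition.exists_upperFunction [Nontrivial (Vec 𝕜 n)] (hS : IsTimeScale S)
    (h0 : ∀ t ∈ S, 0 ≤ t) (ha : 0 ≤ a) (hΨ : IsTransition S A a Ψ) {L : ℝ} (hL : 1 ≤ L)
    {τ : ℕ → ℝ} (hτ0 : τ 0 = 0) (hτS : ∀ i, τ i ∈ S) (hτL : ∀ i, τ i + L ≤ τ (i + 1))
    (hτgap : ∀ i, ∀ s ∈ S, s < τ (i + 1) → s < τ i + L) :
    ∃ (g : ℝ → ℝ) (C : ℝ), ContDiff ℝ 1 g ∧ g 0 = 0 ∧ IsUpperFunction S A (expRate S g) ∧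
      (∀ i, Real.exp (g (τ (i + 1))) =
        ‖Ψ (τ (i + 1)) * Ring.inverse (Ψ (τ i))‖ * Real.exp (g (τ i))) ∧
      ∀ i, ∀ t ∈ S, τ i ≤ t → t < τ (i + 1) → |g t - g (τ i)| ≤ C := by
  have hτ1 : ∀ i, τ i + 1 ≤ τ (i + 1) := fun i => by linarith [hτL i]
  have hm : Monotone τ := monotone_nat_of_le_succ fun k => by linarith [hτ1 k]
  set N : ℕ → ℝ := fun i => ‖Ψ (τ (i + 1)) * Ring.inverse (Ψ (τ i))‖ with hN
  have hNpos : ∀ i, 0 < N i := fun i => by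
    have h1 : IsUnit (Ψ (τ (i + 1)) * Ring.inverse (Ψ (τ i))) :=
      (hΨ.isUnit hS h0 (hτS _)).mul (hΨ.isUnit hS h0 (hτS i)).ringInverse
    exact norm_pos_iff.2 h1.ne_zero
  have hσ : ∀ i : ℕ, (i : ℝ) ≤ τ (i + 1) - 1 := fun i => by
    have := mul_le_blockTimes hτ0 hτ1 (i + 1)
    push_cast at this
    linarith
  -- The increment `log (N i)` is placed in the last unit of the block, so that a long final gap,
  -- whose `N i` may be uncontrolled, affects `g` at no point of `S` before `τ (i + 1)`.
  set g : ℝ → ℝ := ramp (fun i => τ (i + 1) - 1) fun i => Real.log (N i) with hg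
  have hgC : ContDiff ℝ 1 g := contDiff_ramp hσ
  have hgblock : ∀ i t, τ i ≤ t → t ≤ τ (i + 1) → g t =
      ∑ j ∈ Finset.range i, Real.log (N j) +
        smoothTransition (t - (τ (i + 1) - 1)) * Real.log (N i) := by
    intro i t h1 h2
    refine ramp_eq hσ (fun j hj => ?_) fun j hj => ?_
    · have := hm (Nat.succ_le_of_lt hj)
      simp only [Nat.succ_eq_add_one] at this
      linarith
    · have := hm (Nat.succ_le_succ (Nat.succ_le_of_lt hj))
      simp only [Nat.succ_eq_add_one] at this
      linarith [hτ1 (i + 1)]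
  have hgτ : ∀ i, g (τ i) = ∑ j ∈ Finset.range i, Real.log (N j) := by
    intro i
    rw [hgblock i (τ i) le_rfl (hm (Nat.le_succ i)),
      smoothTransition.zero_of_nonpos (by linarith [hτ1 i]), zero_mul, add_zero]
  have hgexp : ∀ i, Real.exp (g (τ (i + 1))) = N i * Real.exp (g (τ i)) := by
    intro i
    rw [hgτ, hgτ, Finset.sum_range_succ, Real.exp_add, Real.exp_log (hNpos i), mul_comm]
  obtain ⟨C₁, hC₁, hinv⟩ := hΨ.exists_norm_inverse_le hS h0 (L + 1)
  set C : ℝ := a * (L + 1) + |Real.log C₁| with hC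
  have hCpos : 0 ≤ C := by positivity
  have hgC' : ∀ i, ∀ t ∈ S, τ i ≤ t → t < τ (i + 1) → |g t - g (τ i)| ≤ C := by
    intro i t ht h1 h2
    rw [hgblock i t h1 h2.le, hgτ, add_sub_cancel_left]
    rcases le_or_gt t (τ (i + 1) - 1) with h3 | h3
    · rw [smoothTransition.zero_of_nonpos (by linarith), zero_mul, abs_zero]
      exact hCpos
    -- A point of `S` in the last unit before the end rules out a long final gap: the block has
    -- length at most `L + 1`, and `log (N i)` is bounded on both sides.
    · have h4 : τ (i + 1) - τ i ≤ L + 1 := by linarith [hτgap i t ht h2]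
      have hle := hm (Nat.le_succ i)
      rw [abs_mul, abs_of_nonneg (smoothTransition.nonneg _)]
      refine (mul_le_of_le_one_left (abs_nonneg _) (smoothTransition.le_one _)).trans ?_
      have h5 : Real.log (N i) ≤ a * (L + 1) := by
        rw [Real.log_le_iff_le_exp (hNpos i)]
        refine (hΨ.norm_mul_inverse_le hS h0 (hτS i) (hτS (i + 1)) hle).trans ?_
        exact Real.exp_le_exp.2 (mul_le_mul_of_nonneg_left h4 ha)
      have h6 : -Real.log (N i) ≤ |Real.log C₁| := by
        refine le_trans ?_ (le_abs_self _)
        rw [← Real.log_inv]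
        refine Real.log_le_log (inv_pos.2 (hNpos i)) ?_
        have h7 := hinv (τ i) (hτS i) (τ (i + 1)) (hτS (i + 1)) hle h4
        refine le_trans ?_ h7
        rw [inv_le_iff_one_le_mul₀ (hNpos i)]
        have h8 : (1 : Mat 𝕜 n) = (Ψ (τ i) * Ring.inverse (Ψ (τ (i + 1)))) *
            (Ψ (τ (i + 1)) * Ring.inverse (Ψ (τ i))) := by
          rw [hΨ.mul_inverse_mul hS h0 (hτS _), Ring.mul_inverse_cancel _
            (hΨ.isUnit hS h0 (hτS i))]
        calc (1 : ℝ) = ‖(1 : Mat 𝕜 n)‖ := norm_one.symm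
          _ ≤ _ := by
            nth_rewrite 1 [h8]
            exact norm_mul_le _ _
      have h9 : 0 ≤ a * (L + 1) := by positivity
      rw [abs_le]
      constructor <;> linarith [abs_nonneg (Real.log C₁)]
  have hprod : ∀ i j, i ≤ j →
      ‖Ψ (τ j) * Ring.inverse (Ψ (τ i))‖ ≤ Real.exp (g (τ j) - g (τ i)) := by
    intro i j hij
    induction j, hij using Nat.le_induction with
    | base =>
      rw [Ring.mul_inverse_cancel _ (hΨ.isUnit hS h0 (hτS i)), sub_self, Real.exp_zero, norm_one]
    | succ j _ ih =>
      rw [← hΨ.mul_inverse_mul hS h0 (hτS j)]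
      calc _ ≤ N j * Real.exp (g (τ j) - g (τ i)) :=
            (norm_mul_le _ _).trans (mul_le_mul_of_nonneg_left ih (norm_nonneg _))
        _ = Real.exp (g (τ (j + 1)) - g (τ i)) := by
          rw [Real.exp_sub, Real.exp_sub, hgexp, mul_div_assoc]
  refine ⟨g, C, hgC, ramp_of_nonpos hσ le_rfl, ?_, hgexp, hgC'⟩
  -- The factors account for the partial block before `t`, for going back from `s` to the start of
  -- its block, and for replacing `g (τ j) - g (τ i)` by `g t - g s`.
  refine hΨ.isUpperFunction_expRate hS h0 hgC
    (C := Real.exp (a * L) * C₁ * Real.exp (2 * C)) (by positivity) fun s hs t ht hst => ?_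
  obtain ⟨i, hi1, hi2⟩ := exists_mem_block hτ0 hτ1 (h0 s hs)
  obtain ⟨j, hj1, hj2⟩ := exists_mem_block hτ0 hτ1 (h0 t ht)
  have hij : i ≤ j := by
    by_contra! h
    have := hm (Nat.succ_le_of_lt h)
    simp only [Nat.succ_eq_add_one] at this
    linarith
  have b1 : ‖Ψ t * Ring.inverse (Ψ (τ j))‖ ≤ Real.exp (a * L) := by
    refine (hΨ.norm_mul_inverse_le hS h0 (hτS j) ht hj1).trans (Real.exp_le_exp.2 ?_)
    exact mul_le_mul_of_nonneg_left (by linarith [hτgap j t ht hj2]) ha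
  have b2 : ‖Ψ (τ i) * Ring.inverse (Ψ s)‖ ≤ C₁ :=
    hinv (τ i) (hτS i) s hs hi1 (by linarith [hτgap i s hs hi2])
  have b3 := abs_le.1 (hgC' i s hs hi1 hi2)
  have b4 := abs_le.1 (hgC' j t ht hj1 hj2)
  have b5 : Real.exp (g (τ j) - g (τ i)) ≤ Real.exp (2 * C) * Real.exp (g t - g s) := by
    rw [← Real.exp_add]
    exact Real.exp_le_exp.2 (by linarith)
  have e1 : Ψ t * Ring.inverse (Ψ s) = (Ψ t * Ring.inverse (Ψ (τ j))) *
      ((Ψ (τ j) * Ring.inverse (Ψ (τ i))) * (Ψ (τ i) * Ring.inverse (Ψ s))) := by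
    rw [hΨ.mul_inverse_mul hS h0 (hτS i), hΨ.mul_inverse_mul hS h0 (hτS j)]
  rw [e1]
  calc _ ≤ Real.exp (a * L) * ((Real.exp (2 * C) * Real.exp (g t - g s)) * C₁) := by
        refine (norm_mul_le _ _).trans (mul_le_mul b1 ?_ (norm_nonneg _) (Real.exp_pos _).le)
        refine (norm_mul_le _ _).trans (mul_le_mul ((hprod i j hij).trans b5) b2
          (norm_nonneg _) (by positivity))
    _ = _ := by ring

theorem centralUpperExponent_le {T : Set ℝ} {u : ℝ → ℝ} (hu : IsUpperFunction (fwd T 0) A u) :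
    centralUpperExponent T A ≤ upperMean (fwd T 0) u :=
  iInf₂_le u hu

/-- Scaling the unbounded solution by a small constant gives solutions with arbitrarily small
initial value that still leave the unit ball. -/
theorem not_stable_of_unbounded {T : Set ℝ} (hT : IsTimeScale T) {x : ℝ → Vec 𝕜 n}
    (hx : IsSolution T A 0 x) (hx0 : x 0 ≠ 0) (hub : ∀ M : ℝ, ∃ t ∈ fwd T 0, M ≤ ‖x t‖) :
    ¬ Stable T A := by
  intro hst
  obtain ⟨δ, hδ, H⟩ := hst 0 hT.zero_mem 1 one_pos
  have hx0' : 0 < ‖x 0‖ := norm_pos_iff.2 hx0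
  set k : ℝ := δ / (2 * ‖x 0‖) with hk
  have hkpos : 0 < k := by positivity
  have hsol : IsSolution T A 0 fun t => k • x t := by
    intro t ht ε hε
    filter_upwards [hx t ht (ε / k) (by positivity)] with s hs
    rw [(A t).map_smul_of_tower, smul_comm _ k, ← smul_sub, ← smul_sub, norm_smul,
      Real.norm_of_nonneg hkpos.le]
    calc _ ≤ k * (ε / k * |sigma (fwd T 0) t - s|) := by gcongr
      _ = _ := by field_simp
  obtain ⟨t, ht, hM⟩ := hub (1 / k)
  have h1 := H _ hsol (by
    rw [norm_smul, Real.norm_of_nonneg hkpos.le, hk]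
    field_simp
    linarith) t ht
  rw [norm_smul, Real.norm_of_nonneg hkpos.le] at h1
  rw [div_le_iff₀ hkpos] at hM
  linarith

end upper

end TimeScale

end

/-! ### The main theorem. -/

theorem theorem6p3 {𝕜 : Type*} [RCLike 𝕜] {n : ℕ} (T : Set ℝ)
    (hT : TimeScale.IsTimeScale T) (A : ℝ → TimeScale.Mat 𝕜 n)
    (hA_rd : TimeScale.RdContinuous T A) (hA_bdd : TimeScale.BoundedOn T A)
    (hA_reg : TimeScale.UniformlyRegressive T A)
    (hA_exp : 0 < TimeScale.centralUpperExponent T A) :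
    ∀ δ : ℝ, 0 < δ → ∃ B : ℝ → TimeScale.Mat 𝕜 n,
      TimeScale.RdContinuous T B ∧ (∀ t ∈ T, ‖B t‖ ≤ δ) ∧
      TimeScale.Regressive T (fun t => A t + B t) ∧
      ¬ TimeScale.Stable T (fun t => A t + B t) := by
  intro δ hδ
  obtain ⟨a₀, ha₀⟩ := hA_bdd
  obtain ⟨hreg, K₀, hK₀⟩ := hA_reg
  have hS := hT.fwd_zero
  have h0 : ∀ t ∈ TimeScale.fwd T 0, 0 ≤ t := fun t ht => ht.2
  have ha : (1 : ℝ) ≤ max 1 a₀ := le_max_left _ _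
  obtain ⟨Ψ, hΨ⟩ := TimeScale.exists_isTransition hS h0 (hA_rd.fwd 0) (a := max 1 a₀)
    (K := max 1 K₀) ha (le_max_left _ _)
    (fun t ht => (ha₀ t ht.1).trans (le_max_right _ _))
    (fun t ht => by
      rw [TimeScale.mu_fwd ht.2]
      exact hreg t ht.1)
    (fun t ht => by
      rw [TimeScale.mu_fwd ht.2]
      exact (hK₀ t ht.1).trans (le_max_right _ _))
  -- For an upper function `expRate g`, the growth rate of `g` reaches the central exponent.
  have hmean : ∀ ε : ℝ, (ε : EReal) < TimeScale.centralUpperExponent T A →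
      ∀ g : ℝ → ℝ, ContDiff ℝ 1 g → g 0 = 0 →
      TimeScale.IsUpperFunction (TimeScale.fwd T 0) A
        (TimeScale.expRate (TimeScale.fwd T 0) g) →
      ∀ N : ℝ, ∃ t ∈ TimeScale.fwd T 0, N ≤ t ∧ 0 < t ∧ ε * t < g t := by
    intro ε hε g hg hg0 hu N
    have h1 := hε.trans_le (TimeScale.centralUpperExponent_le hu)
    have h2 := frequently_lt_of_lt_limsup (by isBoundedDefault) h1
    have h3 : ∀ᶠ t in atTop ⊓ 𝓟 (TimeScale.fwd T 0), t ∈ TimeScale.fwd T 0 ∧ N ≤ t ∧ 0 < t :=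
      (eventually_inf_principal.2 (Eventually.of_forall fun t ht => ht)).and
        (((eventually_ge_atTop N).and (eventually_gt_atTop 0)).filter_mono inf_le_left)
    obtain ⟨t, ht1, htS, htN, ht0⟩ := (h2.and_eventually h3).exists
    refine ⟨t, htS, htN, ht0, ?_⟩
    rw [EReal.coe_lt_coe_iff, TimeScale.deltaIntegral_cylinder_expRate hS h0 hg hS.zero_mem htS,
      hg0, sub_zero, one_div, lt_inv_mul_iff₀ ht0, mul_comm] at ht1
    exact ht1
  obtain ⟨ε, hε0, hεχ⟩ := EReal.lt_iff_exists_real_btwn.1 hA_exp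
  have hεpos : 0 < ε := by exact_mod_cast hε0
  rcases subsingleton_or_nontrivial (TimeScale.Vec 𝕜 n) with hsub | hnt
  -- In dimension zero `g = 0` already gives an upper function, contradicting the positive exponent.
  · obtain ⟨t, _, _, ht0, ht⟩ := hmean ε hεχ (fun _ => 0) contDiff_const rfl
      (hΨ.isUpperFunction_expRate hS h0 contDiff_const one_pos fun s _ t _ _ => by
        rw [Subsingleton.elim (Ψ t * Ring.inverse (Ψ s)) 0, norm_zero]
        positivity) 0
    linarith [mul_pos hεpos ht0]
  obtain ⟨η, hη, hpert⟩ := TimeScale.exists_perturbation hT (by linarith) hA_rd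
    (fun t ht => (ha₀ t ht).trans (le_max_right 1 a₀)) hreg hΨ hδ
  -- Since `i * L ≤ τ i ≤ t`, this choice gives `i * |log η| ≤ ε * t / 2`, half of the growth
  -- available from `g`.
  set L : ℝ := max 1 (2 * |Real.log η| / ε) with hL
  obtain ⟨τ, hτ0, hτS, hτL, hτgap⟩ := TimeScale.exists_blockTimes hS L
  have hL1 : 1 ≤ L := le_max_left _ _
  have hLη : 2 * |Real.log η| ≤ ε * L := by
    have := le_max_right 1 (2 * |Real.log η| / ε)
    rw [← hL, div_le_iff₀ hεpos] at this
    linarith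
  obtain ⟨g, C, hgC, hg0, hgu, hgexp, hgle⟩ := hΨ.exists_upperFunction hS h0 (by linarith) hL1
    hτ0 hτS hτL hτgap
  obtain ⟨B, hB1, hB2, hB3, x, hx, hx0, hgrow⟩ := hpert τ hτ0 hτS
    fun i => by linarith [hτL i]
  refine ⟨B, hB1, hB2, hB3, TimeScale.not_stable_of_unbounded hT hx hx0 fun M => ?_⟩
  have hx0' : 0 < ‖x 0‖ := norm_pos_iff.2 hx0
  have hlow : ∀ i : ℕ, η ^ i * Real.exp (g (τ i)) * ‖x 0‖ ≤ ‖x (τ i)‖ := by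
    intro i
    induction i with
    | zero => rw [hτ0, hg0, Real.exp_zero, pow_zero, one_mul, one_mul]
    | succ i ih =>
      refine le_trans ?_ (hgrow i)
      rw [hgexp i, pow_succ]
      have h1 : 0 ≤ η * ‖Ψ (τ (i + 1)) * Ring.inverse (Ψ (τ i))‖ := by positivity
      calc _ = η * ‖Ψ (τ (i + 1)) * Ring.inverse (Ψ (τ i))‖ *
            (η ^ i * Real.exp (g (τ i)) * ‖x 0‖) := by ring
        _ ≤ _ := mul_le_mul_of_nonneg_left ih h1
  -- The threshold makes the remaining `ε * t / 2` cover both the error `C`, paid for moving from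
  -- `t` back to the block start `τ i`, and the logarithm of the target size.
  obtain ⟨t, htS, htN, ht0, ht⟩ := hmean ε hεχ g hgC hg0 hgu
    (2 * (C + |Real.log (max M 1 / ‖x 0‖)|) / ε)
  obtain ⟨i, hi1, hi2⟩ := TimeScale.exists_mem_block hτ0 (fun i => by linarith [hτL i]) ht0.le
  refine ⟨τ i, hτS i, ?_⟩
  have hMpos : 0 < max M 1 / ‖x 0‖ := by positivity
  have e1 : η ^ i = Real.exp (i * Real.log η) := by
    rw [mul_comm, Real.exp_mul, Real.exp_log hη, Real.rpow_natCast]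
  have e2 : -(ε * t / 2) ≤ i * Real.log η := by
    have h1 := TimeScale.mul_le_blockTimes hτ0 hτL i
    have h2 : (i : ℝ) * (2 * |Real.log η|) ≤ i * (ε * L) := by gcongr
    have h3 : ε * (i * L) ≤ ε * t := mul_le_mul_of_nonneg_left (h1.trans hi1) hεpos.le
    have h4 : (i : ℝ) * -|Real.log η| ≤ i * Real.log η :=
      mul_le_mul_of_nonneg_left (neg_abs_le _) (Nat.cast_nonneg i)
    linarith
  have e3 := (abs_le.1 (hgle i t htS hi1 hi2)).2
  have e4 : Real.log (max M 1 / ‖x 0‖) ≤ i * Real.log η + g (τ i) := by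
    rw [div_le_iff₀ hεpos] at htN
    linarith [le_abs_self (Real.log (max M 1 / ‖x 0‖))]
  refine le_trans ?_ (hlow i)
  rw [e1, ← Real.exp_add]
  rw [Real.log_le_iff_le_exp hMpos, div_le_iff₀ hx0'] at e4
  exact (le_max_left M 1).trans e4
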